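/- **One-loop necklace kernel.** Write $B\left[\begin{smallmatrix}x\\y\end{smallmatrix}\right]=\frac{\Gamma(x)\Gamma(y-x)}{\Gamma(y)}$ and $\Gamma(a\pm b)=\Gamma(a+b)\Gamma(a-b)$, with all sign combinations for several $\pm$. *Chain.* Consider a chain of $r\ge1$ bulk vertices $A_1,\dots,A_r$ with boundary points $1,\dots,n$ ($n\ge2$) of dimensions $\Delta_k$, each vertex carrying at least one of them ($A_a$ also denotes the set of its points, and $\Delta_{A_a}=\sum_{k\in A_a}\Delta_k$), and with two more boundary points, $0$ at $A_1$ of dimension $h-c$ and $n+1$ at $A_r$ of dimension $h+c$. Let $\tau_{ij}=\tau_{ji}$ be Mellin variables of these $n+2$ points with $\tau_{0,n+1}=0$, i.e. $\sum_{j\ne k}\tau_{jk}=\Delta_k$ for $1\le k\le n$, $\sum_k\tau_{0k}=h-c$, $\sum_k\tau_{k,n+1}=h+c$ (so $\sum_{1\le i<j\le n}\tau_{ij}=\frac12\sum_k\Delta_k-h$). Let $\delta_{ij}$ be Mellin variables of the points $1,\dots,n$: $\delta_{ij}=\delta_{ji}$, $\delta_{ii}=-\Delta_i$, $\sum_j\delta_{ij}=0$.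 For $a\le b$ put $$\xi_{a,b}=\sum_{i\in A_a\sqcup\dots\sqcup A_b}\Delta_i-2\sum_{i<j\in A_a\sqcup\dots\sqcup A_b}\tau_{ij},\qquad s_{a,b}=\sum_{i\in A_a\sqcup\dots\sqcup A_b}\Delta_i-2\sum_{i<j\in A_a\sqcup\dots\sqcup A_b}\delta_{ij},$$ $\xi_{a,b}=s_{a,b}=0$ for $a>b$, $\xi_a=\xi_{a,a}$, $s_a=s_{a,a}$, and let $$\Xi_a=h+c+\xi_{a,r}-2\sum_{k\in A_a\sqcup\dots\sqcup A_r}\tau_{k,n+1}\quad(2\le a\le r),\qquad \Xi_1=h-c,\quad \Xi_{r+1}=h+c.$$ Then $\xi_{1,r}=2h$, and $\xi_a=\Delta_{A_a}$ if $A_a$ has a single point. *Loop formation.* For a function $M_0$ of $\Xi_2,\dots,\Xi_r$, the pre-amplitude obtained by gluing $0$ and $n+1$ is the Mellin integral $$M[\delta]=\int[\mathrm d\tau]'\,M_0[\Xi]\prod_{k=1}^n\frac{\Gamma(\tau_{0k})\Gamma(\tau_{k,n+1})}{\Gamma(\tau_{0k}+\tau_{k,n+1})}\prod_{1\le i<j\le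 n}\frac{\Gamma(\tau_{ij})\Gamma(\delta_{ij}-\tau_{ij})}{\Gamma(\delta_{ij})},$$ where $[\mathrm d\tau]'$ is the product of $\frac{\mathrm d\tau}{2\pi i}$ over the independent variables: all $\tau_{ij}$ ($1\le i<j\le n$) but one, and all $\tau_{k,n+1}$ but one (the omitted ones are arbitrary). The contours are vertical lines directed upwards on which the arguments of all Gamma functions in the numerators have positive real part; $\delta$ is assumed to be such that such lines exist, and any such lines are allowed. *Claim.* Let the integral defining $M[\delta]$ converge absolutely. Then the following integral converges absolutely, and $M$ equals $$M[s]=\frac{1}{(-2)^{\sharp[\Xi,\xi]}}\int[\mathrm d\Xi][\mathrm d\xi]\,M_0[\Xi]\,K_2\,K_1,$$ $$K_2=\prod_{a=1}^{r}\frac{\Gamma\left[\frac{(\xi_{a,r}-\xi_{a+1,r})-(\Xi_a-\Xi_{a+1})}{2}\right]\Gamma\left[\frac{(\Xi_a-\Xi_{a+1})-(\xi_{1,a-1}-\xi_{1,a})}{2}\right]}{\Gamma\left[\frac{(\xi_{a,r}-\xi_{a+1,r})-(\xi_{1,a-1}-\xi_{1,a})}{2}\right]},$$ $$K_1=\prod_{\substack{1\le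 a\le r\\ |A_a|\ge2}}B\left[\begin{smallmatrix}\frac{\Delta_{A_a}-\xi_a}{2}\\ \frac{\Delta_{A_a}-s_a}{2}\end{smallmatrix}\right]\prod_{1\le a<b\le r}B\left[\begin{smallmatrix}\frac{\xi_{a,b-1}+\xi_{a+1,b}-\xi_{a+1,b-1}-\xi_{a,b}}{2}\\ \frac{s_{a,b-1}+s_{a+1,b}-s_{a+1,b-1}-s_{a,b}}{2}\end{smallmatrix}\right].$$ The integration variables are $\Xi_2,\dots,\Xi_r$ and the $\xi_{a,b}$ with $1\le a\le b\le r$, except $\xi_{1,r}$ and except $\xi_{a,a}$ when $|A_a|=1$, which have the fixed values above; $\sharp[\Xi,\xi]$ is their number, and $[\mathrm d\Xi][\mathrm d\xi]$ is the product of their $\frac{\mathrm d\Xi_a}{2\pi i}$, $\frac{\mathrm d\xi_{a,b}}{2\pi i}$. Their contours are the images of the $\tau$ contours with the orientation given by the change of variables, i.e. vertical lines directed from $+i\infty$ to $-i\infty$ (with all lines directed upwards the prefactor is $2^{-\sharp[\Xi,\xi]}$). *The chain pre-amplitude.* In particular, let $M_0$ be the tree pre-amplitude of the chain with spectrum variables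 $c_2,\dots,c_r$ ($c_a$ on the propagator between $A_{a-1}$ and $A_a$). For $r\ge2$ it is $$M_0=\prod_{a=2}^r\Gamma\left[\tfrac{h\pm c_a-\Xi_a}{2}\right]\cdot\frac{\Gamma\left[\frac{\Delta_{A_1}-c\pm c_2}{2}\right]}{\Gamma\left[\frac{\Delta_{A_1}+h-c-\Xi_2}{2}\right]}\cdot\frac{\Gamma\left[\frac{\Delta_{A_r}+c\pm c_r}{2}\right]}{\Gamma\left[\frac{\Delta_{A_r}+h+c-\Xi_r}{2}\right]}\cdot\prod_{a=2}^{r-1}\Gamma\left[\tfrac{\Delta_{A_a}\pm c_a\pm c_{a+1}}{2}\right]C_a,$$ $$C_a=\int\frac{\mathrm dw_1\,\mathrm dw_2}{(2\pi i)^2}\,\frac{\Gamma\left[\frac{\Delta_{A_a}+c_a+c_{a+1}}{2}+w_1+w_2\right]}{\Gamma\left[\frac{\Delta_{A_a}\pm c_a\pm c_{a+1}}{2}\right]}\prod_{b=1}^{2}\frac{\Gamma[-w_b]\,\Gamma[-c_{a+b-1}-w_b]\,\Gamma\left[\frac{h+c_{a+b-1}-\Xi_{a+b-1}}{2}+w_b\right]}{\Gamma\left[\frac{h\pm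 c_{a+b-1}-\Xi_{a+b-1}}{2}\right]},$$ and for $r=1$ it is $M_0=\Gamma\left[\frac12\sum_k\Delta_k\right]$. If the contours of $\tau$ and $w$ are vertical lines on which also the arguments $\frac{h\pm c_a-\Xi_a}{2}$ and those of the Gamma functions in the numerators of the $C_a$ that depend on $w$ have positive real part, then both integrals converge absolutely, and the formula holds. -/

import Mathlib

open MeasureTheory

noncomputable section

/-! ### Mellin integrals along straight contours -/

/-- The point with parameters `x` on the product of the vertical lines `Re z_j = σ_j`,
traversed from `-i∞` to `+i∞`. -/
def upwardLine {ι : Type*} (σ : ι → ℝ) (x : ι → ℝ) : ι → ℂ :=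
  fun j => (σ j : ℂ) + (x j : ℂ) * Complex.I

/-- The same product of vertical lines, each traversed from `+i∞` to `-i∞`. -/
def downwardLine {ι : Type*} (σ : ι → ℝ) (x : ι → ℝ) : ι → ℂ :=
  fun j => (σ j : ℂ) - (x j : ℂ) * Complex.I

/-- `∫ ∏_j dz_j / (2πi) f(z)`, every `z_j` running from `σ_j - i∞` to `σ_j + i∞`;
here `dz / (2πi) = dx / (2π)`. -/
def mellinUp {ι : Type*} [Fintype ι] (σ : ι → ℝ) (f : (ι → ℂ) → ℂ) : ℂ :=
  (1 / (2 * (Real.pi : ℂ))) ^ Fintype.card ι * ∫ x : ι → ℝ, f (upwardLine σ x)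

/-- `∫ ∏_j dz_j / (2πi) f(z)`, every `z_j` running from `σ_j + i∞` to `σ_j - i∞`;
here `dz / (2πi) = - dx / (2π)`. -/
def mellinDown {ι : Type*} [Fintype ι] (σ : ι → ℝ) (f : (ι → ℂ) → ℂ) : ℂ :=
  (-1 / (2 * (Real.pi : ℂ))) ^ Fintype.card ι * ∫ x : ι → ℝ, f (downwardLine σ x)

/-- `B[x; y] = Γ(x) Γ(y - x) / Γ(y)`. -/
def betaB (x y : ℂ) : ℂ :=
  Complex.Gamma x * Complex.Gamma (y - x) / Complex.Gamma y

/-! ### The chain and its Mellin variables -/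

/-- A chain of `r` bulk vertices `A_1, …, A_r` with boundary points `1, …, n` (here `Fin n`)
of dimensions `Δ`, each vertex carrying at least one of them, and with two further boundary
points `0` (attached to `A_1`, of dimension `h - c`) and `n + 1` (attached to `A_r`, of
dimension `h + c`), which are to be glued into a loop. The vertex `A_a` is
`a - 1 : Fin r`. -/
structure NecklaceChain (n r : ℕ) where
  /-- the vertex to which a boundary point is attached -/
  vertex : Fin n → Fin r
  vertex_surjective : Function.Surjective vertex
  /-- half of the boundary dimension -/
  h : ℂ
  /-- the spectrum variable of the propagator closing the loop -/
  c : ℂ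
  /-- the conformal dimensions -/
  Δ : Fin n → ℂ

/-- Mellin variables of the points `0, 1, …, n + 1` with `τ_{0,n+1} = 0`. -/
structure LoopMellinPoint (n : ℕ) where
  /-- `τ_{ij}` for `1 ≤ i, j ≤ n` -/
  inner : Fin n → Fin n → ℂ
  /-- `τ_{0k}` -/
  left : Fin n → ℂ
  /-- `τ_{k,n+1}` -/
  right : Fin n → ℂ

/-- Labels of the independent Mellin variables: all `τ_{ij}` with `i < j` other than `τ_e`,
and all `τ_{k,n+1}` with `k ≠ p`. -/
abbrev IndepVar {n : ℕ} (e : Fin n × Fin n) (p : Fin n) : Type :=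
  {q : Fin n × Fin n // q.1 < q.2 ∧ q ≠ e} ⊕ {k : Fin n // k ≠ p}

namespace NecklaceChain

variable {n r : ℕ} (N : NecklaceChain n r)

/-- The boundary points of `A_a ⊔ ⋯ ⊔ A_b` (empty if `a > b`). -/
def segment (a b : ℕ) : Finset (Fin n) :=
  Finset.univ.filter fun k => a ≤ (N.vertex k : ℕ) + 1 ∧ (N.vertex k : ℕ) + 1 ≤ b

/-- `Δ_{A_a}`, the total dimension of the points among `1, …, n` attached to `A_a`. -/
def vertexDim (a : ℕ) : ℂ := ∑ k ∈ N.segment a a, N.Δ k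

/-- The Mandelstam variable `∑_{i ∈ S} Δ_i - 2 ∑_{i < j ∈ S} δ_{ij}`. -/
def mandelstam (S : Finset (Fin n)) (δ : Fin n → Fin n → ℂ) : ℂ :=
  ∑ i ∈ S, N.Δ i - 2 * ∑ i ∈ S, ∑ j ∈ S.filter (fun j => i < j), δ i j

/-- The constraints on the Mellin variables `δ` of the necklace diagram. -/
def IsCanonical (δ : Fin n → Fin n → ℂ) : Prop :=
  (∀ i j, δ i j = δ j i) ∧ (∀ i, δ i i = - N.Δ i) ∧ ∀ i, ∑ j, δ i j = 0

/-- `s_{a,b}` (and likewise `ξ_{a,b}`, for `τ` in place of `δ`). -/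
def planar (δ : Fin n → Fin n → ℂ) (a b : ℕ) : ℂ := N.mandelstam (N.segment a b) δ

/-- `Ξ_a`: the Mandelstam variable of `A_a ⊔ ⋯ ⊔ A_r ⊔ {n + 1}`. -/
def chainMandelstam (τ : LoopMellinPoint n) (a : ℕ) : ℂ :=
  N.h + N.c + N.mandelstam (N.segment a r) τ.inner - 2 * ∑ k ∈ N.segment a r, τ.right k

/-- The Mellin variables `τ`, with `τ_{0,n+1} = 0`, obtained from the independent ones by solving
`∑_{i<j} τ_{ij} = ∑ Δ / 2 - h` for `τ_e`, `∑_k τ_{k,n+1} = h + c` for `τ_{p,n+1}`, and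
`τ_{0k} + τ_{k,n+1} + ∑_{j ≠ k} τ_{kj} = Δ_k` for `τ_{0k}`. -/
def solve (e : Fin n × Fin n) (p : Fin n) (z : IndepVar e p → ℂ) : LoopMellinPoint n :=
  let pair : Fin n × Fin n → ℂ := fun q =>
    if hq : q.1 < q.2 ∧ q ≠ e then z (Sum.inl ⟨q, hq⟩)
    else (∑ k, N.Δ k) / 2 - N.h - ∑ q', z (Sum.inl q')
  let inner : Fin n → Fin n → ℂ := fun i j =>
    if i < j then pair (i, j) else if j < i then pair (j, i) else - N.Δ i
  let right : Fin n → ℂ := fun k =>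
    if hk : k ≠ p then z (Sum.inr ⟨k, hk⟩) else N.h + N.c - ∑ k', z (Sum.inr k')
  { inner := inner
    right := right
    left := fun k => N.Δ k - right k - ∑ j ∈ Finset.univ.filter (fun j => j ≠ k), inner k j }

/-! ### Loop formation -/

/-- The kernel of loop formation, independent of the original diagram. -/
def preKernel (τ : LoopMellinPoint n) (δ : Fin n → Fin n → ℂ) : ℂ :=
  (∏ k, Complex.Gamma (τ.left k) * Complex.Gamma (τ.right k) /
      Complex.Gamma (τ.left k + τ.right k)) *
    ∏ i, ∏ j ∈ Finset.Ioi i, Complex.Gamma (τ.inner i j) *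
      Complex.Gamma (δ i j - τ.inner i j) / Complex.Gamma (δ i j)

/-- The integrand `M₀ K_pre` of loop formation, where `M₀` is a function of the
variables `Ξ_2, …, Ξ_r`. -/
def loopIntegrand (M₀ : (Finset.Icc 2 r → ℂ) → ℂ) (δ : Fin n → Fin n → ℂ)
    (e : Fin n × Fin n) (p : Fin n) (z : IndepVar e p → ℂ) : ℂ :=
  M₀ (fun a => N.chainMandelstam (N.solve e p z) a) * preKernel (N.solve e p z) δ

/-- The pre-amplitude of the diagram formed by gluing `0` and `n + 1`:
`M[δ] = ∫ [dτ]' M₀ K_pre`, on the contours `Re z = σ`. -/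
def loopPreAmplitude (M₀ : (Finset.Icc 2 r → ℂ) → ℂ) (δ : Fin n → Fin n → ℂ)
    (e : Fin n × Fin n) (p : Fin n) (σ : IndepVar e p → ℝ) : ℂ :=
  mellinUp σ (N.loopIntegrand M₀ δ e p)

/-- The lines `Re z = σ` separate left from right poles of all Gamma functions of `K_pre`:
every argument in a numerator has positive real part on them. -/
def IsLoopContour (δ : Fin n → Fin n → ℂ) (e : Fin n × Fin n) (p : Fin n)
    (σ : IndepVar e p → ℝ) : Prop :=
  (∀ k, 0 < ((N.solve e p fun v => (σ v : ℂ)).left k).re) ∧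
  (∀ k, 0 < ((N.solve e p fun v => (σ v : ℂ)).right k).re) ∧
  ∀ i j, i < j → 0 < ((N.solve e p fun v => (σ v : ℂ)).inner i j).re ∧
    0 < (δ i j - (N.solve e p fun v => (σ v : ℂ)).inner i j).re

/-! ### The reduced formula -/

/-- The channels `(a, b)` whose `ξ_{a,b}` is an integration variable: all `1 ≤ a ≤ b ≤ r` except
`(1, r)`, and except `(a, a)` when `A_a` carries a single boundary point. -/
def freeChannels : Finset (ℕ × ℕ) :=
  (Finset.Icc 1 r ×ˢ Finset.Icc 1 r).filter fun q =>
    q.1 ≤ q.2 ∧ q ≠ (1, r) ∧ ¬ (q.1 = q.2 ∧ (N.segment q.1 q.1).card = 1)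

/-- Labels of the remaining integration variables `Ξ_2, …, Ξ_r` and free `ξ_{a,b}`. -/
abbrev ReducedVar : Type := Finset.Icc 2 r ⊕ N.freeChannels

/-- `Ξ_1, …, Ξ_{r+1}`, with `Ξ_1 = h - c` and `Ξ_{r+1} = h + c`. -/
def fullChain (Z : N.ReducedVar → ℂ) (a : ℕ) : ℂ :=
  if ha : a ∈ Finset.Icc 2 r then Z (Sum.inl ⟨a, ha⟩)
  else if a ≤ 1 then N.h - N.c else N.h + N.c

/-- All `ξ_{a,b}`, with `ξ_{1,r} = 2h`, with `ξ_{a,a} = Δ_{A_a}` if `A_a` carries a single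
boundary point, and with `ξ_{a,b} = 0` for `a > b`. -/
def fullPlanar (Z : N.ReducedVar → ℂ) (a b : ℕ) : ℂ :=
  if hq : (a, b) ∈ N.freeChannels then Z (Sum.inr ⟨(a, b), hq⟩)
  else if (a, b) = (1, r) then 2 * N.h
  else if a = b then N.vertexDim a
  else 0

/-- `K₂`, with one Beta function for each vertex. -/
def kernelTwo (X : ℕ → ℂ) (ξ : ℕ → ℕ → ℂ) : ℂ :=
  ∏ a ∈ Finset.Icc 1 r,
    Complex.Gamma (((ξ a r - ξ (a + 1) r) - (X a - X (a + 1))) / 2) *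
      Complex.Gamma (((X a - X (a + 1)) - (ξ 1 (a - 1) - ξ 1 a)) / 2) /
      Complex.Gamma (((ξ a r - ξ (a + 1) r) - (ξ 1 (a - 1) - ξ 1 a)) / 2)

/-- `K₁`, with one Beta function for each vertex (absent if that vertex carries a single
boundary point) and one for each pair `a < b`. -/
def kernelOne (ξ s : ℕ → ℕ → ℂ) : ℂ :=
  (∏ a ∈ (Finset.Icc 1 r).filter (fun a => (N.segment a a).card ≠ 1),
      betaB ((N.vertexDim a - ξ a a) / 2) ((N.vertexDim a - s a a) / 2)) *
    ∏ a ∈ Finset.Icc 1 r, ∏ b ∈ Finset.Ioc a r,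
      betaB ((ξ a (b - 1) + ξ (a + 1) b - ξ (a + 1) (b - 1) - ξ a b) / 2)
        ((s a (b - 1) + s (a + 1) b - s (a + 1) (b - 1) - s a b) / 2)

/-- The reduced integrand `M₀[Ξ] K[Ξ, ξ; s]` with `K = K₂ K₁`. -/
def reducedIntegrand (M₀ : (Finset.Icc 2 r → ℂ) → ℂ) (s : ℕ → ℕ → ℂ)
    (Z : N.ReducedVar → ℂ) : ℂ :=
  M₀ (fun a => Z (Sum.inl a)) *
    (kernelTwo (r := r) (N.fullChain Z) (N.fullPlanar Z) * N.kernelOne (N.fullPlanar Z) s)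

/-- The real parts of `Ξ` and `ξ` on the contour `Re z = σ`. -/
def reducedContour (e : Fin n × Fin n) (p : Fin n) (σ : IndepVar e p → ℝ) :
    N.ReducedVar → ℝ :=
  Sum.elim (fun a => (N.chainMandelstam (N.solve e p fun v => (σ v : ℂ)) a).re)
    (fun q => (N.planar (N.solve e p fun v => (σ v : ℂ)).inner q.1.1 q.1.2).re)

/-! ### The tree pre-amplitude of the chain -/

/-- `Γ[(h ± c - s)/2]`, the factor of a propagator. -/
def propagatorFactor (h c s : ℂ) : ℂ :=
  Complex.Gamma ((h + c - s) / 2) * Complex.Gamma ((h - c - s) / 2)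

/-- The factor of a vertex with one propagator, `D` the total dimension of its boundary points. -/
def endVertex (h D c s : ℂ) : ℂ :=
  Complex.Gamma ((D - h + c) / 2) * Complex.Gamma ((D - h - c) / 2) / Complex.Gamma ((D - s) / 2)

/-- `Γ[(D ± c ± c')/2]`. -/
def gammaPM (D c c' : ℂ) : ℂ :=
  Complex.Gamma ((D + c + c') / 2) * Complex.Gamma ((D + c - c') / 2) *
    Complex.Gamma ((D - c + c') / 2) * Complex.Gamma ((D - c - c') / 2)

/-- The factor that each propagator contributes to the correction function of a vertex. -/
def correctionLeg (h c s w : ℂ) : ℂ :=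
  Complex.Gamma (-w) * Complex.Gamma (-c - w) * Complex.Gamma ((h + c - s) / 2 + w) /
    propagatorFactor h c s

/-- The correction function of a vertex with two propagators, as a Mellin integral on the
lines `Re w = ω`. -/
def vertexCorrection (h D c c' s s' : ℂ) (ω : Fin 2 → ℝ) : ℂ :=
  mellinUp ω fun w => Complex.Gamma ((D + c + c') / 2 + w 0 + w 1) / gammaPM D c c' *
    (correctionLeg h c s (w 0) * correctionLeg h c' s' (w 1))

/-- The factor of the vertex `A_a` in the chain; `γ_a` is the spectrum variable of the propagator
between `A_{a-1}` and `A_a`, and `ω_a` gives the contour of the correction function. -/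
def vertexFactor (γ : ℕ → ℂ) (ω : ℕ → Fin 2 → ℝ) (X : ℕ → ℂ) (a : ℕ) : ℂ :=
  if r = 1 then Complex.Gamma ((N.vertexDim 1 + (N.h - N.c) + (N.h + N.c)) / 2 - N.h)
  else if a = 1 then endVertex N.h (N.vertexDim 1 + (N.h - N.c)) (γ 2) (X 2)
  else if a = r then endVertex N.h (N.vertexDim r + (N.h + N.c)) (γ r) (X r)
  else gammaPM (N.vertexDim a) (γ a) (γ (a + 1)) *
    vertexCorrection N.h (N.vertexDim a) (γ a) (γ (a + 1)) (X a) (X (a + 1)) (ω a)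

/-- The tree pre-amplitude of the chain, by the diagrammatic rules: a factor for each propagator
and a factor for each vertex. -/
def chainPreAmplitude (γ : ℕ → ℂ) (ω : ℕ → Fin 2 → ℝ) (Ξ : Finset.Icc 2 r → ℂ) : ℂ :=
  let X : ℕ → ℂ := fun a => if ha : a ∈ Finset.Icc 2 r then Ξ ⟨a, ha⟩ else 0
  (∏ a ∈ Finset.Icc 2 r, propagatorFactor N.h (γ a) (X a)) *
    ∏ a ∈ Finset.Icc 1 r, N.vertexFactor γ ω X a

/-- The contours separate left from right poles of the Gamma functions of the chain
pre-amplitude, the real parts of `Ξ` being `X`. -/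
def IsChainContour (γ : ℕ → ℂ) (ω : ℕ → Fin 2 → ℝ) (X : ℕ → ℝ) : Prop :=
  (∀ a ∈ Finset.Icc 2 r, 0 < (N.h + γ a).re - X a ∧ 0 < (N.h - γ a).re - X a) ∧
  ∀ a ∈ Finset.Ioo 1 r,
    ω a 0 < 0 ∧ ω a 0 < -(γ a).re ∧ 0 < ((N.h + γ a).re - X a) / 2 + ω a 0 ∧
    ω a 1 < 0 ∧ ω a 1 < -(γ (a + 1)).re ∧
    0 < ((N.h + γ (a + 1)).re - X (a + 1)) / 2 + ω a 1 ∧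
    0 < (N.vertexDim a + γ a + γ (a + 1)).re / 2 + ω a 0 + ω a 1

end NecklaceChain

end

/-! ### Bounds for the Gamma and Beta functions on vertical lines -/

theorem norm_Gamma_le_Gamma_re {z : ℂ} (hz : 0 < z.re) :
    ‖Complex.Gamma z‖ ≤ Real.Gamma z.re := by
  rw [Complex.Gamma_eq_integral hz, Real.Gamma_eq_integral hz, Complex.GammaIntegral]
  refine (norm_integral_le_integral_norm _).trans (le_of_eq ?_)
  refine setIntegral_congr_fun measurableSet_Ioi fun x hx => ?_
  have hx : 0 < x := hx
  simp only [norm_mul, Complex.norm_cpow_eq_rpow_re_of_pos hx, Complex.sub_re, Complex.one_re,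
    Complex.norm_real, Real.norm_eq_abs, abs_of_pos (Real.exp_pos _)]

theorem one_add_abs_im_le {p : ℝ} (hp : 0 < p) {a : ℂ} (ha : a.re = p) :
    1 + |a.im| ≤ (1 + 1 / p) * ‖a‖ := by
  have h1 := Complex.abs_im_le_norm a
  have h2 : p ≤ ‖a‖ := ha ▸ (le_abs_self a.re).trans (Complex.abs_re_le_norm a)
  have h3 : 1 ≤ 1 / p * ‖a‖ := by
    rw [one_div, ← div_eq_inv_mul, le_div_iff₀ hp]; linarith
  linarith

theorem norm_le_one_add_abs_im (a : ℂ) : ‖a‖ ≤ (1 + |a.re|) * (1 + |a.im|) := by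
  have h := Complex.norm_le_abs_re_add_abs_im a
  nlinarith [abs_nonneg a.re, abs_nonneg a.im]

/-- The Gamma function decays on vertical lines faster than any power. -/
theorem exists_norm_Gamma_le (m : ℕ) : ∀ {p : ℝ}, 0 < p →
    ∃ C, 0 < C ∧ ∀ a : ℂ, a.re = p → ‖Complex.Gamma a‖ ≤ C * ((1 + |a.im|) ^ m)⁻¹ := by
  induction m with
  | zero =>
    intro p hp
    refine ⟨Real.Gamma p, Real.Gamma_pos_of_pos hp, fun a ha => ?_⟩
    have := norm_Gamma_le_Gamma_re (z := a) (by rw [ha]; exact hp)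
    simpa [ha] using this
  | succ m ih =>
    intro p hp
    obtain ⟨C, hC, h⟩ := ih (p := p + 1) (by linarith)
    have hp' : 0 < 1 + 1 / p := by positivity
    refine ⟨C * (1 + 1 / p), by positivity, fun a ha => ?_⟩
    have ha0 : a ≠ 0 := by rintro rfl; simp at ha; linarith
    have h1 := h (a + 1) (by simp [ha])
    rw [Complex.Gamma_add_one a ha0, norm_mul] at h1
    simp only [Complex.add_im, Complex.one_im, add_zero] at h1
    have h2 := one_add_abs_im_le hp ha
    have h3 : 0 < 1 + |a.im| := by positivity
    have h4 : 0 < (1 + |a.im|) ^ m := by positivity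
    rw [← div_eq_mul_inv, le_div_iff₀ h4] at h1
    rw [← div_eq_mul_inv, le_div_iff₀ (by positivity), pow_succ]
    calc ‖Complex.Gamma a‖ * ((1 + |a.im|) ^ m * (1 + |a.im|))
        ≤ ‖Complex.Gamma a‖ * ((1 + |a.im|) ^ m * ((1 + 1 / p) * ‖a‖)) := by gcongr
      _ = (‖a‖ * ‖Complex.Gamma a‖ * (1 + |a.im|) ^ m) * (1 + 1 / p) := by ring
      _ ≤ C * (1 + 1 / p) := by gcongr

theorem Gamma_ne_zero_of_re_eq {p : ℝ} (hp : 0 < p) {a : ℂ} (ha : a.re = p) :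
    Complex.Gamma a ≠ 0 := Complex.Gamma_ne_zero_of_re_pos (ha ▸ hp)

/-- The Beta function on vertical lines decays faster than any power of `Im a`, if the imaginary
part of `a + b` is bounded. -/
theorem exists_norm_beta_le (m : ℕ) : ∀ {p q : ℝ}, 0 < p → 0 < q →
    ∃ C, 0 < C ∧ ∀ a b : ℂ, a.re = p → b.re = q →
      ‖Complex.Gamma a * Complex.Gamma b / Complex.Gamma (a + b)‖ ≤
        C * ((1 + |(a + b).im|) ^ m * ((1 + |a.im|) ^ m)⁻¹) := by
  induction m with
  | zero =>
    intro p q hp hq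
    refine ⟨‖Complex.betaIntegral p q‖ + 1, by positivity, fun a b ha hb => ?_⟩
    have hab : Complex.Gamma (a + b) ≠ 0 :=
      Gamma_ne_zero_of_re_eq (add_pos hp hq) (by simp [ha, hb])
    rw [Complex.Gamma_mul_Gamma_eq_betaIntegral (ha ▸ hp) (hb ▸ hq), mul_div_cancel_left₀ _ hab]
    have key : ‖Complex.betaIntegral a b‖ ≤ ∫ x in (0 : ℝ)..1, x ^ (p - 1) * (1 - x) ^ (q - 1) := by
      rw [Complex.betaIntegral]
      refine (intervalIntegral.norm_integral_le_integral_norm zero_le_one).trans (le_of_eq ?_)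
      refine intervalIntegral.integral_congr_ae ?_
      have h1 : ∀ᵐ x : ℝ, x ≠ 1 := by simp [ae_iff, measure_singleton]
      filter_upwards [h1] with x hx1 hx
      rw [Set.uIoc_of_le zero_le_one] at hx
      have hx0 : 0 < x := hx.1
      have hx2 : 0 < 1 - x := by have := lt_of_le_of_ne hx.2 hx1; linarith
      have : (1 - (x : ℂ)) = ((1 - x : ℝ) : ℂ) := by push_cast; ring
      rw [norm_mul, this, Complex.norm_cpow_eq_rpow_re_of_pos hx0,
        Complex.norm_cpow_eq_rpow_re_of_pos hx2]
      simp [ha, hb]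
    have key2 : (∫ x in (0 : ℝ)..1, x ^ (p - 1) * (1 - x) ^ (q - 1)) ≤
        ‖Complex.betaIntegral p q‖ := by
      have : Complex.betaIntegral p q =
          ((∫ x in (0 : ℝ)..1, x ^ (p - 1) * (1 - x) ^ (q - 1) : ℝ) : ℂ) := by
        rw [Complex.betaIntegral, ← intervalIntegral.integral_ofReal]
        refine intervalIntegral.integral_congr fun x hx => ?_
        rw [Set.uIcc_of_le zero_le_one] at hx
        rw [Complex.ofReal_mul, Complex.ofReal_cpow hx.1,
          Complex.ofReal_cpow (by linarith [hx.2])]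
        push_cast; rfl
      rw [this, Complex.norm_real]
      exact le_abs_self _
    simp only [pow_zero, mul_one, inv_one]
    linarith
  | succ m ih =>
    intro p q hp hq
    obtain ⟨C, hC, h⟩ := ih (p := p + 1) (q := q) (by linarith) hq
    have hp' : 0 < 1 + 1 / p := by positivity
    refine ⟨C * ((1 + |p + q|) * (1 + 1 / p)), by positivity, fun a b ha hb => ?_⟩
    have ha0 : a ≠ 0 := by rintro rfl; simp at ha; linarith
    have hab0 : a + b ≠ 0 := fun h0 => by
      have := congrArg Complex.re h0; simp [ha, hb] at this; linarith
    have h1 := h (a + 1) b (by simp [ha]) hb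
    have e1 : a + 1 + b = a + b + 1 := by ring
    rw [e1, Complex.Gamma_add_one a ha0, Complex.Gamma_add_one _ hab0] at h1
    have im1 : (a + b + 1).im = (a + b).im := by simp
    have im2 : (a + 1).im = a.im := by simp
    rw [im1, im2] at h1
    have hG : Complex.Gamma (a + b) ≠ 0 :=
      Gamma_ne_zero_of_re_eq (add_pos hp hq) (by simp [ha, hb])
    have e2 : Complex.Gamma a * Complex.Gamma b / Complex.Gamma (a + b) =
        (a * Complex.Gamma a * Complex.Gamma b / ((a + b) * Complex.Gamma (a + b))) *
          ((a + b) / a) := by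
      field_simp
    rw [e2, norm_mul]
    have h2 := one_add_abs_im_le hp ha
    have h3 : ‖a + b‖ ≤ (1 + |p + q|) * (1 + |(a + b).im|) := by
      have := norm_le_one_add_abs_im (a + b)
      rwa [Complex.add_re, ha, hb] at this
    have h4 : ‖(a + b) / a‖ ≤ ((1 + |p + q|) * (1 + 1 / p)) *
        ((1 + |(a + b).im|) * (1 + |a.im|)⁻¹) := by
      rw [norm_div, div_le_iff₀ (norm_pos_iff.mpr ha0)]
      have h5 : 1 ≤ (1 + 1 / p) * (1 + |a.im|)⁻¹ * ‖a‖ := by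
        rw [mul_right_comm, ← div_eq_mul_inv, le_div_iff₀ (by positivity)]; linarith
      calc ‖a + b‖ ≤ (1 + |p + q|) * (1 + |(a + b).im|) * 1 := by linarith
        _ ≤ (1 + |p + q|) * (1 + |(a + b).im|) * ((1 + 1 / p) * (1 + |a.im|)⁻¹ * ‖a‖) := by
            gcongr
        _ = _ := by ring
    calc _ ≤ (C * ((1 + |(a + b).im|) ^ m * ((1 + |a.im|) ^ m)⁻¹)) *
          (((1 + |p + q|) * (1 + 1 / p)) * ((1 + |(a + b).im|) * (1 + |a.im|)⁻¹)) := by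
            gcongr
      _ = _ := by rw [pow_succ, pow_succ, mul_inv]; ring

theorem betaB_eq (x y : ℂ) :
    betaB x y = Complex.Gamma x * Complex.Gamma (y - x) / Complex.Gamma (x + (y - x)) := by
  rw [betaB, add_sub_cancel]

theorem exists_norm_betaB_le (m : ℕ) {p q : ℝ} (hp : 0 < p) (hq : p < q) :
    ∃ C, 0 < C ∧ ∀ x y : ℂ, x.re = p → y.re = q →
      ‖betaB x y‖ ≤ C * ((1 + |y.im|) ^ m * ((1 + |x.im|) ^ m)⁻¹) := by
  obtain ⟨C, hC, h⟩ := exists_norm_beta_le m hp (sub_pos.mpr hq)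
  refine ⟨C, hC, fun x y hx hy => ?_⟩
  have := h x (y - x) hx (by simp [hx, hy])
  rwa [← betaB_eq, add_sub_cancel] at this

theorem measurable_Gamma : Measurable Complex.Gamma := by
  have h : Measurable fun s : ℂ => (Complex.Gamma s)⁻¹ :=
    Complex.differentiable_one_div_Gamma.continuous.measurable
  have e : Complex.Gamma = (fun s : ℂ => (Complex.Gamma s)⁻¹)⁻¹ := by ext s; simp
  rw [e]
  exact h.inv

theorem Measurable.betaB {α : Type*} [MeasurableSpace α] {f g : α → ℂ} (hf : Measurable f)
    (hg : Measurable g) : Measurable fun x => betaB (f x) (g x) :=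
  ((measurable_Gamma.comp hf).mul (measurable_Gamma.comp (hg.sub hf))).div
    (measurable_Gamma.comp hg)

/-- The quotient of two Gamma functions grows at most polynomially on vertical lines. -/
theorem exists_norm_Gamma_div_Gamma_le {α : ℂ} (hα : 0 < α.re) (β : ℂ) :
    ∃ C, ∃ m : ℕ, 0 < C ∧ ∀ y : ℝ, ‖Complex.Gamma (α + y * Complex.I) /
      Complex.Gamma (β + y * Complex.I)‖ ≤ C * (1 + |y|) ^ m := by
  obtain ⟨m, hm⟩ : ∃ m : ℕ, α.re - β.re < m := exists_nat_gt _
  induction m generalizing β with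
  | zero =>
    have hm : α.re < β.re := by push_cast at hm; linarith
    obtain ⟨C, hC, h⟩ := exists_norm_betaB_le 0 hα hm
    have hG : 0 < ‖Complex.Gamma (β - α)‖ :=
      norm_pos_iff.mpr (Complex.Gamma_ne_zero_of_re_pos (by simpa using hm))
    refine ⟨C / ‖Complex.Gamma (β - α)‖, 0, by positivity, fun y => ?_⟩
    have h1 := h (α + y * Complex.I) (β + y * Complex.I) (by simp) (by simp)
    rw [_root_.betaB, add_sub_add_right_eq_sub, mul_div_right_comm, norm_mul] at h1
    simp only [pow_zero, inv_one, mul_one] at h1 ⊢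
    rwa [le_div_iff₀ hG]
  | succ m ih =>
    obtain ⟨C, k, hC, h⟩ := ih (β + 1) (by simp only [Complex.add_re, Complex.one_re];
                                           push_cast at hm; linarith)
    refine ⟨C * (1 + ‖β‖), k + 1, by positivity, fun y => ?_⟩
    have h1 := h y
    have h2 : ‖β + y * Complex.I‖ ≤ (1 + ‖β‖) * (1 + |y|) := by
      have := norm_add_le β (y * Complex.I)
      rw [norm_mul, Complex.norm_I, mul_one, Complex.norm_real, Real.norm_eq_abs] at this
      nlinarith [norm_nonneg β, abs_nonneg y]
    have h3 := Complex.one_div_Gamma_eq_self_mul_one_div_Gamma_add_one (β + y * Complex.I)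
    rw [div_eq_mul_inv, h3, mul_left_comm, norm_mul, add_right_comm, ← div_eq_mul_inv]
    calc _ ≤ ((1 + ‖β‖) * (1 + |y|)) * (C * (1 + |y|) ^ k) := by gcongr
      _ = _ := by ring

/-! ### The Beta function as a Fourier integral, and Barnes' first lemma -/

open scoped FourierTransform

/-- The function of which the Beta function `B[s; δ]` is the two-sided Laplace transform in `s`:
it is `e^{sv} (1 + e^v)^{-δ}`. -/
noncomputable def betaKernel (s δ : ℂ) (v : ℝ) : ℂ :=
  Complex.exp (s * v) * (Real.sigmoid (-v) : ℂ) ^ δ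

theorem sigmoid_neg_ofReal_ne_zero (v : ℝ) : (Real.sigmoid (-v) : ℂ) ≠ 0 :=
  Complex.ofReal_ne_zero.mpr (Real.sigmoid_pos _).ne'

theorem betaKernel_mul (s s' δ δ' : ℂ) (v : ℝ) :
    betaKernel s δ v * betaKernel s' δ' v = betaKernel (s + s') (δ + δ') v := by
  simp only [betaKernel]
  rw [Complex.cpow_add _ _ (sigmoid_neg_ofReal_ne_zero v), add_mul, Complex.exp_add]
  ring

theorem continuous_betaKernel (s δ : ℂ) : Continuous (betaKernel s δ) := by
  unfold betaKernel
  refine Continuous.mul (by fun_prop) ?_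
  refine Continuous.cpow ?_ continuous_const fun v => ?_
  · exact Complex.continuous_ofReal.comp (continuous_sigmoid.comp continuous_neg)
  · exact Complex.ofReal_mem_slitPlane.mpr (Real.sigmoid_pos _)

theorem betaKernel_eq (s δ : ℂ) (v : ℝ) :
    betaKernel s δ v = |Real.sigmoid v * (1 - Real.sigmoid v)| •
      ((Real.sigmoid v : ℂ) ^ (s - 1) * (1 - (Real.sigmoid v : ℂ)) ^ (δ - s - 1)) := by
  have h0 := Real.sigmoid_pos v
  have h1 : 0 < 1 - Real.sigmoid v := sub_pos.mpr (Real.sigmoid_lt_one v)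
  have e0 : (Real.sigmoid v : ℂ) ≠ 0 := Complex.ofReal_ne_zero.mpr h0.ne'
  have e1 : ((1 - Real.sigmoid v : ℝ) : ℂ) ≠ 0 := Complex.ofReal_ne_zero.mpr h1.ne'
  have e2 : (1 - (Real.sigmoid v : ℂ)) = ((1 - Real.sigmoid v : ℝ) : ℂ) := by push_cast; ring
  have e3 : Real.sigmoid v = Real.exp v * (1 - Real.sigmoid v) := by
    have := Real.sigmoid_mul_rexp_neg v
    rw [Real.sigmoid_neg] at this
    rw [← this, mul_comm, mul_assoc, ← Real.exp_add]; simp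
  rw [abs_of_pos (mul_pos h0 h1), Complex.real_smul, Complex.ofReal_mul, e2]
  have e4 : (Real.sigmoid v : ℂ) ^ (s - 1) * (Real.sigmoid v : ℂ) = (Real.sigmoid v : ℂ) ^ s := by
    rw [← sub_add_cancel s 1, Complex.cpow_add _ _ e0, Complex.cpow_one, add_sub_cancel_right]
  have e5 : ((1 - Real.sigmoid v : ℝ) : ℂ) ^ (δ - s - 1) * ((1 - Real.sigmoid v : ℝ) : ℂ) =
      ((1 - Real.sigmoid v : ℝ) : ℂ) ^ (δ - s) := by
    rw [← sub_add_cancel (δ - s) 1, Complex.cpow_add _ _ e1, Complex.cpow_one,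
      add_sub_cancel_right]
  have e6 : (Real.sigmoid v : ℂ) ^ s =
      Complex.exp (s * v) * ((1 - Real.sigmoid v : ℝ) : ℂ) ^ s := by
    nth_rewrite 1 [e3]
    rw [Complex.ofReal_mul, Complex.mul_cpow_ofReal_nonneg (Real.exp_pos v).le h1.le,
      Complex.ofReal_exp, ← Complex.exp_log (Complex.exp_ne_zero (v : ℂ)), Complex.cpow_def_of_ne_zero
      (Complex.exp_ne_zero _), Complex.exp_log (Complex.exp_ne_zero (v : ℂ)), ← Complex.ofReal_exp,
      ← Complex.ofReal_log (Real.exp_pos v).le, Real.log_exp, mul_comm (v : ℂ)]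
  calc betaKernel s δ v = Complex.exp (s * v) * (((1 - Real.sigmoid v : ℝ) : ℂ) ^ s *
        ((1 - Real.sigmoid v : ℝ) : ℂ) ^ (δ - s)) := by
        rw [← Complex.cpow_add _ _ e1, betaKernel, Real.sigmoid_neg]; simp
    _ = (Real.sigmoid v : ℂ) ^ (s - 1) * (Real.sigmoid v : ℂ) *
        (((1 - Real.sigmoid v : ℝ) : ℂ) ^ (δ - s - 1) * ((1 - Real.sigmoid v : ℝ) : ℂ)) := by
        rw [e4, e5, e6]; ring
    _ = _ := by ring

theorem integrable_betaKernel {s δ : ℂ} (hs : 0 < s.re) (hδ : s.re < δ.re) :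
    Integrable (betaKernel s δ) := by
  have h := Complex.betaIntegral_convergent (u := s) (v := δ - s) hs (by simpa using hδ)
  rw [intervalIntegrable_iff_integrableOn_Ioo_of_le zero_le_one, ← Real.range_sigmoid,
    ← Set.image_univ, integrableOn_image_iff_integrableOn_abs_deriv_smul MeasurableSet.univ
      (fun x _ => (Real.hasDerivAt_sigmoid x).hasDerivWithinAt) Real.sigmoid_injective.injOn,
    integrableOn_univ] at h
  exact h.congr (Filter.Eventually.of_forall fun v => (betaKernel_eq s δ v).symm)

theorem integral_betaKernel {s δ : ℂ} (hs : 0 < s.re) (hδ : s.re < δ.re) :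
    ∫ v, betaKernel s δ v = betaB s δ := by
  have hδ0 : 0 < δ.re := hs.trans hδ
  rw [betaB, Complex.Gamma_mul_Gamma_eq_betaIntegral hs (by simpa using hδ), add_sub_cancel,
    mul_div_cancel_left₀ _ (Complex.Gamma_ne_zero_of_re_pos hδ0), Complex.betaIntegral,
    intervalIntegral.integral_of_le zero_le_one, integral_Ioc_eq_integral_Ioo,
    ← Real.range_sigmoid, ← Set.image_univ,
    integral_image_eq_integral_abs_deriv_smul MeasurableSet.univ
      (fun x _ => (Real.hasDerivAt_sigmoid x).hasDerivWithinAt) Real.sigmoid_injective.injOn,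
    setIntegral_univ]
  exact integral_congr_ae (Filter.Eventually.of_forall fun v => betaKernel_eq s δ v)

theorem fourier_betaKernel {s δ : ℂ} (hs : 0 < s.re) (hδ : s.re < δ.re) (u : ℝ) :
    𝓕 (betaKernel s δ) u = betaB (s + (-(2 * Real.pi * u) : ℝ) * Complex.I) δ := by
  rw [← integral_betaKernel (by simpa using hs) (by simpa using hδ), Real.fourier_eq']
  refine integral_congr_ae (Filter.Eventually.of_forall fun v => ?_)
  simp only [betaKernel, smul_eq_mul]
  rw [← mul_assoc, ← Complex.exp_add]
  congr 2
  simp only [RCLike.inner_apply, conj_trivial]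
  push_cast
  ring

theorem integrable_betaB {s δ : ℂ} (hs : 0 < s.re) (hδ : s.re < δ.re) :
    Integrable fun u : ℝ => betaB (s + u * Complex.I) δ := by
  have h : ∀ u : ℝ, (s + u * Complex.I).im = s.im + u := fun u => by simp
  obtain ⟨C, hC, hb⟩ := exists_norm_betaB_le 2 hs hδ
  have hi : Integrable fun u : ℝ => C * ((1 + |δ.im|) ^ 2 * (1 + (s.im + u) ^ 2)⁻¹) := by
    have := (integrable_inv_one_add_sq.comp_add_left s.im).const_mul (C * (1 + |δ.im|) ^ 2)
    exact this.congr (Filter.Eventually.of_forall fun u => by ring)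
  refine hi.mono' (Measurable.betaB (by fun_prop) measurable_const).aestronglyMeasurable
    (Filter.Eventually.of_forall fun u => ?_)
  refine (hb (s + u * Complex.I) δ (by simp) rfl).trans ?_
  rw [h]
  have : 1 + (s.im + u) ^ 2 ≤ (1 + |s.im + u|) ^ 2 := by
    nlinarith [abs_nonneg (s.im + u), sq_abs (s.im + u)]
  gcongr

/-- **Barnes' first lemma**, as a convolution identity for Beta functions. -/
theorem integral_betaB_mul_betaB {s δ Y ε : ℂ} (hs : 0 < s.re) (hδ : s.re < δ.re)
    (hY : 0 < (Y - s).re) (hε : (Y - s).re < ε.re) :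
    ∫ u : ℝ, betaB (s + u * Complex.I) δ * betaB (Y - (s + u * Complex.I)) ε =
      2 * Real.pi * betaB Y (δ + ε) := by
  have hpi := Real.pi_pos
  have h1 := integrable_betaKernel hs hδ
  have h2 := integrable_betaKernel hY hε
  have h3 : Integrable (𝓕 (betaKernel (Y - s) ε)) := by
    have e := (integrable_betaB hY hε).comp_mul_left' (R := -(2 * Real.pi))
      (by simp [hpi.ne'])
    refine e.congr (Filter.Eventually.of_forall fun u => ?_)
    rw [fourier_betaKernel hY hε]
    simp only [neg_mul]
  have h4 : Integrable (𝓕⁻ (betaKernel (Y - s) ε)) := by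
    refine h3.comp_neg.congr (Filter.Eventually.of_forall fun u => ?_)
    simp only [Real.fourierInv_eq_fourier_neg]
  have key := VectorFourier.integral_fourierIntegral_smul_eq_flip (L := innerₗ ℝ)
      (μ := volume) (ν := volume) Real.continuous_fourierChar continuous_inner h1 h4
  rw [flip_innerₗ] at key
  change ∫ ξ, 𝓕 (betaKernel s δ) ξ • 𝓕⁻ (betaKernel (Y - s) ε) ξ =
    ∫ x, betaKernel s δ x • 𝓕 (𝓕⁻ (betaKernel (Y - s) ε)) x at key
  rw [(continuous_betaKernel _ _).fourier_fourierInv_eq h2 h3] at key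
  simp only [smul_eq_mul, betaKernel_mul, add_sub_cancel] at key
  have hsum : Y.re < (δ + ε).re := by
    simp only [Complex.sub_re] at hε; simp only [Complex.add_re]; linarith
  have hY0 : 0 < Y.re := by simp only [Complex.sub_re] at hY; linarith
  rw [integral_betaKernel hY0 hsum] at key
  rw [← key]
  have h5 := Measure.integral_comp_mul_left
    (fun u : ℝ => betaB (s + u * Complex.I) δ * betaB (Y - (s + u * Complex.I)) ε)
    (-(2 * Real.pi))
  have h6 : ∀ ξ : ℝ, 𝓕 (betaKernel s δ) ξ * 𝓕⁻ (betaKernel (Y - s) ε) ξ =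
      betaB (s + ((-(2 * Real.pi) * ξ : ℝ) : ℂ) * Complex.I) δ *
        betaB (Y - (s + ((-(2 * Real.pi) * ξ : ℝ) : ℂ) * Complex.I)) ε := fun ξ => by
    rw [fourier_betaKernel hs hδ, Real.fourierInv_eq_fourier_neg, fourier_betaKernel hY hε]
    congr 2 <;> push_cast <;> ring
  simp only [h6]
  rw [h5, Complex.real_smul, abs_inv, abs_neg, abs_of_pos (by positivity), ← mul_assoc]
  push_cast
  rw [mul_inv_cancel₀ (by simp [hpi.ne']), one_mul]

/-! ### Fibre integrals of products of Beta functions -/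

theorem integrable_prod_betaB {ι κ : Type*} [Fintype ι] [Fintype κ] {z δ : ι → ℂ}
    (hz : ∀ i, 0 < (z i).re) (hδ : ∀ i, (z i).re < (δ i).re) {W : (ι → ℝ) → κ → ℂ}
    {ε : κ → ℂ} {p : κ → ℝ} (hW : ∀ b, Measurable fun u => W u b) (hp : ∀ u b, (W u b).re = p b)
    (hp0 : ∀ b, 0 < p b) (hε : ∀ b, p b < (ε b).re) :
    Integrable fun u : ι → ℝ => (∏ i, betaB (z i + u i * Complex.I) (δ i)) *
      ∏ b, betaB (W u b) (ε b) := by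
  have h1 : Integrable fun u : ι → ℝ => ∏ i, betaB (z i + u i * Complex.I) (δ i) :=
    Integrable.fintype_prod (f := fun i (x : ℝ) => betaB (z i + x * Complex.I) (δ i))
      (fun i => integrable_betaB (hz i) (hδ i))
  choose C hC hb using fun b => exists_norm_betaB_le 0 (hp0 b) (hε b)
  refine h1.mul_bdd (c := ∏ b, C b) ?_ (Filter.Eventually.of_forall fun u => ?_)
  · exact (Finset.measurable_prod _ fun b _ =>
      (hW b).betaB measurable_const).aestronglyMeasurable
  · rw [norm_prod]
    refine Finset.prod_le_prod (fun b _ => norm_nonneg _) fun b _ => ?_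
    simpa using hb b (W u b) (ε b) (hp u b) rfl

theorem integral_prod_betaB_fin {κ : Type*} [Fintype κ] [DecidableEq κ] (m : ℕ) :
    ∀ (π : Fin m → κ) (z δ : Fin m → ℂ) (Y ε : κ → ℂ), (∀ i, 0 < (z i).re) →
      (∀ i, (z i).re < (δ i).re) →
      (∀ b, 0 < (Y b - ∑ i, if π i = b then z i else 0).re) →
      (∀ b, (Y b - ∑ i, if π i = b then z i else 0).re < (ε b).re) →
      ∫ u : Fin m → ℝ, (∏ i, betaB (z i + u i * Complex.I) (δ i)) *
        ∏ b, betaB (Y b - ∑ i, if π i = b then z i + u i * Complex.I else 0) (ε b) =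
      (2 * Real.pi) ^ m * ∏ b, betaB (Y b) (ε b + ∑ i, if π i = b then δ i else 0) := by
  induction m with
  | zero =>
    intro π z δ Y ε _ _ _ _
    rw [volume_pi, Measure.pi_of_empty _ (fun i => i.elim0), integral_dirac]
    simp
  | succ m ih =>
    intro π z δ Y ε hz hδ hY hε
    have hre : ∀ (u : Fin (m + 1) → ℝ) b,
        (Y b - ∑ i, if π i = b then z i + u i * Complex.I else 0).re =
        (Y b - ∑ i, if π i = b then z i else 0).re := fun u b => by
      simp only [Complex.sub_re, Complex.re_sum]
      congr 1
      refine Finset.sum_congr rfl fun i _ => ?_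
      split_ifs <;> simp
    have hint : Integrable fun u : Fin (m + 1) → ℝ =>
        (∏ i, betaB (z i + u i * Complex.I) (δ i)) *
        ∏ b, betaB (Y b - ∑ i, if π i = b then z i + u i * Complex.I else 0) (ε b) := by
      refine integrable_prod_betaB hz hδ (fun b => ?_) hre hY hε
      refine measurable_const.sub (Finset.measurable_sum _ fun i _ => ?_)
      split_ifs <;> fun_prop
    set g : (Fin (m + 1) → ℝ) → ℂ := fun u =>
        (∏ i, betaB (z i + u i * Complex.I) (δ i)) *
        ∏ b, betaB (Y b - ∑ i, if π i = b then z i + u i * Complex.I else 0) (ε b) with hg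
    change ∫ u, g u = _
    have mp := (volume_preserving_piFinSuccAbove (fun _ : Fin (m + 1) => ℝ) 0).symm
    rw [← mp.integral_comp']
    rw [← mp.integrable_comp_emb (MeasurableEquiv.measurableEmbedding _)] at hint
    rw [Measure.volume_eq_prod, integral_prod (fun y => g _) hint]
    have hsum : ∀ b, (∑ i, if π i = b then z i else 0) =
        (if π 0 = b then z 0 else 0) + ∑ i : Fin m, if π i.succ = b then z i.succ else 0 :=
      fun b => Fin.sum_univ_succ _
    have inner : ∀ x : ℝ,
        (∫ u' : Fin m → ℝ, g ((MeasurableEquiv.piFinSuccAbove (fun _ : Fin (m + 1) => ℝ) 0).symm (x, u'))) =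
        (betaB (z 0 + x * Complex.I) (δ 0) *
          betaB (Y (π 0) - (z 0 + x * Complex.I))
            (ε (π 0) + ∑ i : Fin m, if π i.succ = π 0 then δ i.succ else 0)) *
        ((2 * Real.pi) ^ m * ∏ b ∈ Finset.univ.erase (π 0), betaB (Y b)
            (ε b + ∑ i : Fin m, if π i.succ = b then δ i.succ else 0)) := fun x => by
      have hih := ih (fun i => π i.succ) (fun i => z i.succ) (fun i => δ i.succ)
        (fun b => Y b - if π 0 = b then z 0 + x * Complex.I else 0) ε (fun i => hz _)
        (fun i => hδ _) (fun b => ?_) (fun b => ?_)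
      · have e : ∀ u' : Fin m → ℝ, g ((MeasurableEquiv.piFinSuccAbove (fun _ : Fin (m + 1) => ℝ) 0).symm (x, u')) =
            betaB (z 0 + x * Complex.I) (δ 0) *
            ((∏ i : Fin m, betaB (z i.succ + u' i * Complex.I) (δ i.succ)) *
            ∏ b, betaB ((Y b - if π 0 = b then z 0 + x * Complex.I else 0) -
              ∑ i : Fin m, if π i.succ = b then z i.succ + u' i * Complex.I else 0) (ε b)) := by
          intro u'
          simp [hg, MeasurableEquiv.piFinSuccAbove, Fin.prod_univ_succ, Fin.sum_univ_succ,
            sub_sub, mul_assoc]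
        simp only [e]
        rw [integral_const_mul, hih, ← Finset.mul_prod_erase _ _ (Finset.mem_univ (π 0))]
        have e2 : ∀ b ∈ Finset.univ.erase (π 0),
            betaB (Y b - if π 0 = b then z 0 + x * Complex.I else 0)
              (ε b + ∑ i : Fin m, if π i.succ = b then δ i.succ else 0) =
            betaB (Y b) (ε b + ∑ i : Fin m, if π i.succ = b then δ i.succ else 0) := by
          intro b hb
          rw [if_neg (Ne.symm (Finset.ne_of_mem_erase hb)), sub_zero]
        rw [Finset.prod_congr rfl e2]
        simp only [if_true]
        ring
      · have := hY b
        rw [hsum] at this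
        simp only [Complex.sub_re, Complex.add_re] at this ⊢
        split_ifs at this ⊢ <;> simp at this ⊢ <;> linarith
      · have := hε b
        rw [hsum] at this
        simp only [Complex.sub_re, Complex.add_re] at this ⊢
        split_ifs at this ⊢ <;> simp at this ⊢ <;> linarith
    rw [integral_congr_ae (Filter.Eventually.of_forall inner), integral_mul_const]
    have hYb := hY (π 0)
    have hεb := hε (π 0)
    rw [hsum, if_pos rfl] at hYb hεb
    have hpos : 0 ≤ (∑ i : Fin m, if π i.succ = π 0 then z i.succ else 0).re := by
      rw [Complex.re_sum]
      refine Finset.sum_nonneg fun i _ => ?_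
      split_ifs
      · exact (hz _).le
      · simp
    have hle : (∑ i : Fin m, if π i.succ = π 0 then z i.succ else 0).re ≤
        (∑ i : Fin m, if π i.succ = π 0 then δ i.succ else 0).re := by
      rw [Complex.re_sum, Complex.re_sum]
      refine Finset.sum_le_sum fun i _ => ?_
      split_ifs
      · exact (hδ _).le
      · simp
    rw [integral_betaB_mul_betaB (hz 0) (hδ 0), ← Finset.mul_prod_erase _ _ (Finset.mem_univ (π 0))]
    · have e3 : δ 0 + (ε (π 0) + ∑ i : Fin m, if π i.succ = π 0 then δ i.succ else 0) =
          ε (π 0) + ∑ i, if π i = π 0 then δ i else 0 := by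
        rw [Fin.sum_univ_succ, if_pos rfl]; ring
      have e4 : ∀ b ∈ Finset.univ.erase (π 0),
          betaB (Y b) (ε b + ∑ i : Fin m, if π i.succ = b then δ i.succ else 0) =
          betaB (Y b) (ε b + ∑ i, if π i = b then δ i else 0) := by
        intro b hb
        rw [Fin.sum_univ_succ, if_neg (Ne.symm (Finset.ne_of_mem_erase hb)), zero_add]
      rw [e3, Finset.prod_congr rfl e4, pow_succ]
      ring
    · simp only [Complex.sub_re, Complex.add_re] at hYb ⊢; linarith
    · simp only [Complex.sub_re, Complex.add_re] at hεb ⊢; linarith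

theorem integral_prod_betaB {ι κ : Type*} [Fintype ι] [Fintype κ] [DecidableEq κ]
    (π : ι → κ) (z δ : ι → ℂ) (Y ε : κ → ℂ) (hz : ∀ i, 0 < (z i).re)
    (hδ : ∀ i, (z i).re < (δ i).re)
    (hY : ∀ b, 0 < (Y b - ∑ i, if π i = b then z i else 0).re)
    (hε : ∀ b, (Y b - ∑ i, if π i = b then z i else 0).re < (ε b).re) :
    ∫ u : ι → ℝ, (∏ i, betaB (z i + u i * Complex.I) (δ i)) *
      ∏ b, betaB (Y b - ∑ i, if π i = b then z i + u i * Complex.I else 0) (ε b) =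
    (2 * Real.pi) ^ Fintype.card ι *
      ∏ b, betaB (Y b) (ε b + ∑ i, if π i = b then δ i else 0) := by
  let f := (Fintype.equivFin ι).symm
  have h := integral_prod_betaB_fin (Fintype.card ι) (π ∘ f) (z ∘ f) (δ ∘ f) Y ε
    (fun i => hz _) (fun i => hδ _)
    (fun b => by
      have := hY b
      rwa [← f.sum_comp] at this)
    (fun b => by
      have := hε b
      rwa [← f.sum_comp] at this)
  simp only [Function.comp_apply] at h
  have hcard : ∀ b, (∑ i, if π (f i) = b then δ (f i) else 0) = ∑ i, if π i = b then δ i else 0 :=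
    fun b => f.sum_comp fun i => if π i = b then δ i else 0
  simp only [hcard] at h
  rw [← h]
  refine ((volume_measurePreserving_piCongrLeft (fun _ : ι => ℝ) f).integral_comp' _).symm.trans ?_
  refine integral_congr_ae (Filter.Eventually.of_forall fun u => ?_)
  simp only [MeasurableEquiv.coe_piCongrLeft]
  rw [← f.prod_comp]
  simp only [← f.sum_comp (fun i => if π i = _ then
    z i + ((Equiv.piCongrLeft (fun _ : ι => ℝ) f) u i : ℂ) * Complex.I else 0)]
  simp only [Equiv.piCongrLeft_apply_apply]

/-- Integrating a product of Beta functions over the sums along the fibres of `π` being fixed: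
`ρ` selects one element of each fibre, and all the others are free. -/
theorem integral_prod_betaB_fibre {ι κ : Type*} [Fintype ι] [Fintype κ] [DecidableEq ι]
    [DecidableEq κ]
    (π : ι → κ) (ρ : κ → ι) (hρ : ∀ b, π (ρ b) = b) (z₀ δ : ι → ℂ) (T : κ → ℂ)
    (z : ({i // ρ (π i) ≠ i} → ℝ) → ι → ℂ)
    (hfree : ∀ u (i : {i // ρ (π i) ≠ i}), z u i = z₀ i + u i * Complex.I)
    (hsum : ∀ u b, (∑ i, if π i = b then z u i else 0) = T b)
    (hz : ∀ u i, 0 < (z u i).re) (hδ : ∀ u i, (z u i).re < (δ i).re) :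
    ∫ u, ∏ i, betaB (z u i) (δ i) =
      (2 * Real.pi) ^ Fintype.card {i // ρ (π i) ≠ i} *
        ∏ b, betaB (T b) (∑ i, if π i = b then δ i else 0) := by
  let R : κ ≃ {i // ¬ ρ (π i) ≠ i} :=
    { toFun := fun b => ⟨ρ b, by simp [hρ]⟩
      invFun := fun i => π i
      left_inv := fun b => hρ b
      right_inv := fun i => Subtype.ext (not_not.mp i.2) }
  have hprod : ∀ f : ι → ℂ, ∏ i, f i = (∏ i : {i // ρ (π i) ≠ i}, f i) * ∏ b, f (ρ b) := fun f => by
    rw [← Fintype.prod_subtype_mul_prod_subtype (fun i => ρ (π i) ≠ i), ← R.prod_comp]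
    rfl
  have hsum' : ∀ (f : ι → ℂ) b, (∑ i, if π i = b then f i else 0) =
      (∑ i : {i // ρ (π i) ≠ i}, if π i = b then f i else 0) + f (ρ b) := fun f b => by
    rw [← Fintype.sum_subtype_add_sum_subtype (fun i => ρ (π i) ≠ i), ← R.sum_comp]
    simp [R, hρ]
  have hrep : ∀ u b, z u (ρ b) = T b - ∑ i : {i // ρ (π i) ≠ i},
      if π i = b then z₀ i + u i * Complex.I else 0 := fun u b => by
    have := hsum u b
    rw [hsum'] at this
    simp only [hfree] at this
    rw [← this]; ring
  have h := integral_prod_betaB (fun i : {i // ρ (π i) ≠ i} => π i) (fun i => z₀ i) (fun i => δ i)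
    T (fun b => δ (ρ b)) (fun i => by simpa [hfree] using hz 0 i)
    (fun i => by simpa [hfree] using hδ 0 i)
    (fun b => by have := hz 0 (ρ b); rw [hrep] at this; simpa using this)
    (fun b => by have := hδ 0 (ρ b); rw [hrep] at this; simpa using this)
  simp only [hprod, hfree, hrep]
  rw [h]
  congr 1
  refine Finset.prod_congr rfl fun b _ => ?_
  rw [hsum' δ b, add_comm]

/-! ### Integral changes of variables -/

/-- The subring of integers in a ring. -/
abbrev integerSubring (R : Type*) [Ring R] : Subring R := (Int.castRingHom R).range

theorem eq_zero_of_forall_mul_mem_integerSubring {x : ℝ}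
    (h : ∀ t : ℝ, t * x ∈ integerSubring ℝ) : x = 0 := by
  by_contra hx
  obtain ⟨m, hm⟩ := h (1 / (2 * x))
  have : (2 * m : ℝ) = 1 := by
    rw [show (m : ℝ) = 1 / (2 * x) * x from hm]; field_simp
  have h2 : (2 * m : ℤ) = 1 := by exact_mod_cast this
  omega

theorem exists_det_eq_intCast {ι : Type*} [Fintype ι] [DecidableEq ι]
    (ψ : (ι → ℝ) →ₗ[ℝ] (ι → ℝ))
    (h : ∀ x, (∀ i, x i ∈ integerSubring ℝ) → ∀ i, ψ x i ∈ integerSubring ℝ) :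
    ∃ d : ℤ, LinearMap.det ψ = d := by
  have h1 : ∀ i j, ∃ m : ℤ, (m : ℝ) = LinearMap.toMatrix' ψ i j := fun i j => by
    obtain ⟨m, hm⟩ := h (Pi.single j 1) (fun k => by
      rcases eq_or_ne k j with rfl | hk
      · simp
      · simp [hk]) i
    exact ⟨m, by rw [LinearMap.toMatrix'_apply]; exact hm⟩
  choose A hA using h1
  refine ⟨(Matrix.of A).det, ?_⟩
  rw [← LinearMap.det_toMatrix']
  have : LinearMap.toMatrix' ψ = (Int.castRingHom ℝ).mapMatrix (Matrix.of A) := by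
    ext i j; simp [← hA]
  rw [this, ← RingHom.map_det]; rfl

/-- A linear map between spaces of the same dimension that preserves and reflects integrality of
the coordinates is invertible and preserves Lebesgue measure. -/
theorem exists_measurePreserving_inverse {ι κ : Type*} [Fintype ι] [Fintype κ]
    (hcard : Fintype.card ι = Fintype.card κ) (φ : (ι → ℝ) →ₗ[ℝ] (κ → ℝ))
    (h : ∀ x, (∀ j, φ x j ∈ integerSubring ℝ) ↔ ∀ i, x i ∈ integerSubring ℝ) :
    ∃ e : (κ → ℝ) ≃ᵐ (ι → ℝ), (∀ y, φ (e y) = y) ∧ MeasurePreserving e := by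
  classical
  have hinj : Function.Injective φ := by
    rw [injective_iff_map_eq_zero]
    intro x hx
    ext i
    refine eq_zero_of_forall_mul_mem_integerSubring fun t => ?_
    refine (h (t • x)).mp (fun j => ?_) i
    rw [map_smul, hx, smul_zero]
    exact zero_mem _
  let L : (ι → ℝ) ≃ₗ[ℝ] (κ → ℝ) := φ.linearEquivOfInjective hinj (by simp [hcard])
  have hL : ∀ x, L x = φ x := fun x => rfl
  let s : κ ≃ ι := Fintype.equivOfCardEq hcard.symm
  let ψ : (ι → ℝ) ≃ₗ[ℝ] (ι → ℝ) := L.trans (LinearEquiv.funCongrLeft ℝ ℝ s.symm)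
  have hψ : ∀ x i, ψ x i = φ x (s.symm i) := fun x i => rfl
  obtain ⟨a, ha⟩ := exists_det_eq_intCast (ψ : (ι → ℝ) →ₗ[ℝ] (ι → ℝ))
    fun x hx i => (h x).mpr hx (s.symm i)
  obtain ⟨b, hb⟩ := exists_det_eq_intCast (ψ.symm : (ι → ℝ) →ₗ[ℝ] (ι → ℝ))
    fun y hy => (h (ψ.symm y)).mp fun j => by
      have : φ (ψ.symm y) j = y (s j) := by
        have := hψ (ψ.symm y) (s j)
        rw [ψ.apply_symm_apply] at this
        simpa using this.symm
      simpa [this] using hy (s j)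
  have hab : a * b = 1 := by
    have : LinearMap.det (ψ : (ι → ℝ) →ₗ[ℝ] (ι → ℝ)) *
        LinearMap.det (ψ.symm : (ι → ℝ) →ₗ[ℝ] (ι → ℝ)) = 1 := ψ.det_mul_det_symm
    rw [ha, hb] at this
    exact_mod_cast this
  have hb1 : |(b : ℝ)| = 1 := by
    have : |b| = 1 := Int.isUnit_iff_abs_eq.mp (IsUnit.of_mul_eq_one a (by rw [mul_comm]; exact hab))
    exact_mod_cast this
  have hb0 : LinearMap.det (ψ.symm : (ι → ℝ) →ₗ[ℝ] (ι → ℝ)) ≠ 0 := by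
    rw [hb]; intro h0; rw [h0] at hb1; simp at hb1
  have mp : MeasurePreserving ψ.symm (volume : Measure (ι → ℝ)) volume := by
    refine ⟨(LinearMap.continuous_of_finiteDimensional
      (ψ.symm : (ι → ℝ) →ₗ[ℝ] (ι → ℝ))).measurable, ?_⟩
    have := Measure.map_linearMap_addHaar_eq_smul_addHaar (volume : Measure (ι → ℝ)) hb0
    rw [hb, abs_inv, hb1, inv_one, ENNReal.ofReal_one, one_smul] at this
    exact this
  let ψe : (ι → ℝ) ≃ᵐ (ι → ℝ) := ψ.symm.toContinuousLinearEquiv.toHomeomorph.toMeasurableEquiv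
  let c := MeasurableEquiv.piCongrLeft (fun _ : ι => ℝ) s
  refine ⟨c.trans ψe, fun y => ?_, ?_⟩
  · have : ∀ i, φ (ψ.symm (c y)) i = y i := fun i => by
      have h1 := hψ (ψ.symm (c y)) (s i)
      rw [ψ.apply_symm_apply, Equiv.symm_apply_apply] at h1
      rw [← h1]
      exact Equiv.piCongrLeft_apply_apply (fun _ : ι => ℝ) s y i
    exact funext this
  · exact MeasurePreserving.comp (g := ψe) mp (volume_measurePreserving_piCongrLeft _ s)

/-! ### Sums over pairs of points and blocks of pairs -/

/-- The unordered pairs of distinct points. -/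
abbrev PointPair (n : ℕ) : Type := {q : Fin n × Fin n // q.1 < q.2}

@[to_additive]
theorem prod_pointPair {n : ℕ} {R : Type*} [CommMonoid R] (F : Fin n → Fin n → R) :
    ∏ q : PointPair n, F q.1.1 q.1.2 = ∏ i, ∏ j, if i < j then F i j else 1 := by
  rw [← Fintype.prod_prod_type' (fun i j => if i < j then F i j else 1), ← Finset.prod_filter]
  exact (Finset.prod_subtype (Finset.univ.filter fun q : Fin n × Fin n => q.1 < q.2)
    (by simp) fun q => F q.1 q.2).symm

theorem sum_sum_eq_sum_pointPair {n : ℕ} {R : Type*} [AddCommMonoid R] (F : Fin n → Fin n → R) :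
    ∑ i, ∑ j, F i j = ∑ q : PointPair n, (F q.1.1 q.1.2 + F q.1.2 q.1.1) + ∑ i, F i i := by
  rw [Finset.sum_add_distrib, sum_pointPair F, sum_pointPair fun i j => F j i,
    Finset.sum_comm (f := fun i j => if i < j then F j i else 0), ← Finset.sum_add_distrib,
    ← Finset.sum_add_distrib]
  refine Finset.sum_congr rfl fun i _ => ?_
  have : F i i = ∑ j, if j = i then F i j else 0 := by simp
  rw [this, ← Finset.sum_add_distrib, ← Finset.sum_add_distrib]
  refine Finset.sum_congr rfl fun j _ => ?_
  rcases lt_trichotomy i j with h | rfl | h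
  · simp [h, h.not_gt, h.ne']
  · simp
  · simp [h, h.not_gt, h.ne]

/-- The symmetric matrix with entries `t` off the diagonal and `-d` on it. -/
def symMatrix {n : ℕ} {R : Type*} [Neg R] (d : Fin n → R) (t : PointPair n → R) (i j : Fin n) : R :=
  if h : i < j then t ⟨(i, j), h⟩ else if h : j < i then t ⟨(j, i), h⟩ else -d i

section symMatrix

variable {n : ℕ} {R : Type*}

theorem symMatrix_lt [Neg R] (d : Fin n → R) (t : PointPair n → R) (q : PointPair n) :
    symMatrix d t q.1.1 q.1.2 = t q := dif_pos q.2

theorem symMatrix_comm [Neg R] (d : Fin n → R) (t : PointPair n → R) (i j : Fin n) :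
    symMatrix d t i j = symMatrix d t j i := by
  unfold symMatrix
  rcases lt_trichotomy i j with h | rfl | h
  · simp [h, h.not_gt]
  · rfl
  · simp [h, h.not_gt]

theorem symMatrix_self [Neg R] (d : Fin n → R) (t : PointPair n → R) (i : Fin n) :
    symMatrix d t i i = -d i := by
  simp [symMatrix]

/-- The sum of `τ` over `S × T`. -/
def blockForm [AddCommMonoid R] (τ : Fin n → Fin n → R) (S T : Finset (Fin n)) : R :=
  ∑ i ∈ S, ∑ j ∈ T, τ i j

/-- The sum of `t` over the pairs in `S`. -/
def pairSum [AddCommMonoid R] (t : PointPair n → R) (S : Finset (Fin n)) : R :=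
  ∑ q : PointPair n, if q.1.1 ∈ S ∧ q.1.2 ∈ S then t q else 0

theorem blockForm_eq_univ [AddCommMonoid R] (τ : Fin n → Fin n → R) (S T : Finset (Fin n)) :
    blockForm τ S T = ∑ i, ∑ j, if i ∈ S ∧ j ∈ T then τ i j else 0 := by
  simp only [blockForm, ite_and]
  rw [← Finset.sum_subset (Finset.subset_univ S)]
  · refine Finset.sum_congr rfl fun i hi => ?_
    rw [← Finset.sum_subset (Finset.subset_univ T)]
    · refine Finset.sum_congr rfl fun j hj => by simp [hi, hj]
    · intro j _ hj; simp [hj]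
  · intro i _ hi; simp [hi]

theorem blockForm_comm [AddCommMonoid R] {τ : Fin n → Fin n → R} (hτ : ∀ i j, τ i j = τ j i)
    (S T : Finset (Fin n)) : blockForm τ S T = blockForm τ T S := by
  rw [blockForm, Finset.sum_comm]
  exact Finset.sum_congr rfl fun j _ => Finset.sum_congr rfl fun i _ => hτ i j

theorem blockForm_symMatrix_self [CommRing R] (d : Fin n → R) (t : PointPair n → R)
    (S : Finset (Fin n)) :
    blockForm (symMatrix d t) S S = 2 * pairSum t S - ∑ i ∈ S, d i := by
  rw [blockForm_eq_univ, sum_sum_eq_sum_pointPair, sub_eq_add_neg, pairSum, Finset.mul_sum]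
  congr 1
  · refine Finset.sum_congr rfl fun q _ => ?_
    rw [symMatrix_comm d t q.1.2, symMatrix_lt]
    by_cases h : q.1.1 ∈ S ∧ q.1.2 ∈ S
    · rw [if_pos h, if_pos h.symm]; ring
    · rw [if_neg h, if_neg fun h' => h h'.symm]; ring
  · simp only [and_self, symMatrix_self, ← Finset.sum_neg_distrib]
    rw [← Finset.sum_filter]; simp

end symMatrix

/-- The first argument of the Beta function of `K₁` that is attached to a channel. -/
def blockArg {R : Type*} [Field R] (D : ℕ → R) (ξ : ℕ → ℕ → R) (q : ℕ × ℕ) : R :=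
  if q.1 = q.2 then (D q.1 - ξ q.1 q.1) / 2
  else (ξ q.1 (q.2 - 1) + ξ (q.1 + 1) q.2 - ξ (q.1 + 1) (q.2 - 1) - ξ q.1 q.2) / 2

namespace NecklaceChain

variable {n r : ℕ} (N : NecklaceChain n r)

theorem mem_segment {a b : ℕ} {k : Fin n} :
    k ∈ N.segment a b ↔ a ≤ (N.vertex k : ℕ) + 1 ∧ (N.vertex k : ℕ) + 1 ≤ b := by
  simp [segment]

theorem segment_eq_empty {a b : ℕ} (h : b < a) : N.segment a b = ∅ := by
  ext k; simp only [mem_segment, Finset.notMem_empty, iff_false]; omega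

theorem segment_one_right : N.segment 1 r = Finset.univ := by
  ext k
  have := (N.vertex k).2
  simp only [mem_segment, Finset.mem_univ, iff_true]; omega

theorem segment_split {a b c : ℕ} (hac : a ≤ c + 1) (hcb : c ≤ b) :
    N.segment a b = N.segment a c ∪ N.segment (c + 1) b := by
  ext k; simp only [Finset.mem_union, mem_segment]; omega

theorem sum_segment_split {R : Type*} [AddCommMonoid R] {a b c : ℕ} (hac : a ≤ c + 1)
    (hcb : c ≤ b) (f : Fin n → R) :
    ∑ k ∈ N.segment a b, f k = ∑ k ∈ N.segment a c, f k + ∑ k ∈ N.segment (c + 1) b, f k := by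
  rw [N.segment_split hac hcb, Finset.sum_union]
  rw [Finset.disjoint_left]
  intro k h1 h2
  rw [mem_segment] at h1 h2
  omega

theorem blockForm_split_left {R : Type*} [AddCommMonoid R] {a b c : ℕ} (hac : a ≤ c + 1)
    (hcb : c ≤ b) (τ : Fin n → Fin n → R) (S : Finset (Fin n)) :
    blockForm τ (N.segment a b) S =
      blockForm τ (N.segment a c) S + blockForm τ (N.segment (c + 1) b) S :=
  N.sum_segment_split hac hcb _

/-- The channels that carry a Beta function of `K₁`. -/
def blocks : Finset (ℕ × ℕ) :=
  (Finset.Icc 1 r ×ˢ Finset.Icc 1 r).filter fun q =>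
    q.1 ≤ q.2 ∧ ¬ (q.1 = q.2 ∧ (N.segment q.1 q.1).card = 1)

theorem mem_blocks {q : ℕ × ℕ} : q ∈ N.blocks ↔ 1 ≤ q.1 ∧ q.1 ≤ q.2 ∧ q.2 ≤ r ∧
    (q.1 = q.2 → (N.segment q.1 q.1).card ≠ 1) := by
  simp only [blocks, Finset.mem_filter, Finset.mem_product, Finset.mem_Icc]
  constructor
  · rintro ⟨⟨⟨h1, h2⟩, h3, h4⟩, h5, h6⟩
    exact ⟨h1, h5, h4, fun h h' => h6 ⟨h, h'⟩⟩
  · rintro ⟨h1, h2, h3, h4⟩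
    exact ⟨⟨⟨h1, h2.trans h3⟩, h1.trans h2, h3⟩, h2, fun h => h4 h.1 h.2⟩

theorem freeChannels_eq : N.freeChannels = N.blocks.erase (1, r) := by
  ext q
  simp only [freeChannels, blocks, Finset.mem_filter, Finset.mem_erase]
  tauto

/-- The channel of the vertices to which the points of a pair are attached. -/
def blockOf (q : PointPair n) : N.blocks :=
  ⟨(min (N.vertex q.1.1 : ℕ) (N.vertex q.1.2) + 1, max (N.vertex q.1.1 : ℕ) (N.vertex q.1.2) + 1), by
    have h1 := (N.vertex q.1.1).2
    have h2 := (N.vertex q.1.2).2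
    rw [mem_blocks]
    refine ⟨by simp, by simp, by simp only; omega, fun h => ?_⟩
    simp only [add_left_inj] at h
    refine ne_of_gt (Finset.one_lt_card.mpr ⟨q.1.1, ?_, q.1.2, ?_, q.2.ne⟩) <;>
    · rw [mem_segment]; simp only; omega⟩

theorem exists_vertex_eq {a : ℕ} (h1 : 1 ≤ a) (h2 : a ≤ r) : ∃ k, (N.vertex k : ℕ) + 1 = a := by
  obtain ⟨k, hk⟩ := N.vertex_surjective ⟨a - 1, by omega⟩
  exact ⟨k, by rw [hk]; simp only; omega⟩

theorem blockOf_surjective : Function.Surjective N.blockOf := by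
  rintro ⟨⟨a, b⟩, hq⟩
  obtain ⟨h1, h2, h3, h4⟩ := N.mem_blocks.mp hq
  simp only at h1 h2 h3 h4
  obtain ⟨i, j, hij, hi, hj⟩ : ∃ i j, i ≠ j ∧ (N.vertex i : ℕ) + 1 = a ∧
      (N.vertex j : ℕ) + 1 = b := by
    rcases h2.eq_or_lt with rfl | hab
    · obtain ⟨k, hk⟩ := N.exists_vertex_eq h1 h3
      have hk' : k ∈ N.segment a a := N.mem_segment.mpr (by omega)
      have hc : 1 < (N.segment a a).card := by
        have := Finset.card_pos.mpr ⟨k, hk'⟩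
        have := h4 rfl
        omega
      obtain ⟨i, hi, j, hj, hij⟩ := Finset.one_lt_card.mp hc
      rw [mem_segment] at hi hj
      exact ⟨i, j, hij, by omega, by omega⟩
    · obtain ⟨i, hi⟩ := N.exists_vertex_eq h1 (h2.trans h3)
      obtain ⟨j, hj⟩ := N.exists_vertex_eq (h1.trans h2) h3
      exact ⟨i, j, by rintro rfl; omega, hi, hj⟩
  rcases lt_or_gt_of_ne hij with h | h
  · refine ⟨⟨(i, j), h⟩, Subtype.ext (Prod.ext ?_ ?_)⟩ <;> simp only [blockOf] <;> omega
  · refine ⟨⟨(j, i), h⟩, Subtype.ext (Prod.ext ?_ ?_)⟩ <;> simp only [blockOf] <;> omega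

theorem blockForm_segment {R : Type*} [CommRing R] (d : Fin n → R) (t : PointPair n → R)
    (β : N.blocks) (hβ : β.1.1 ≠ β.1.2) :
    blockForm (symMatrix d t) (N.segment β.1.1 β.1.1) (N.segment β.1.2 β.1.2) =
      ∑ q, if N.blockOf q = β then t q else 0 := by
  have hle := (N.mem_blocks.mp β.2).2.1
  rw [blockForm_eq_univ, sum_sum_eq_sum_pointPair]
  have h0 : (∑ i, if i ∈ N.segment β.1.1 β.1.1 ∧ i ∈ N.segment β.1.2 β.1.2 then
      symMatrix d t i i else 0) = 0 := by
    refine Finset.sum_eq_zero fun i _ => if_neg ?_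
    simp only [mem_segment]; omega
  rw [h0, add_zero]
  refine Finset.sum_congr rfl fun q _ => ?_
  rw [symMatrix_comm d t q.1.2, symMatrix_lt]
  simp only [mem_segment, blockOf, Subtype.ext_iff, Prod.ext_iff]
  split_ifs <;> first | omega | simp

theorem pairSum_segment {R : Type*} [AddCommMonoid R] (t : PointPair n → R) (β : N.blocks)
    (hβ : β.1.1 = β.1.2) :
    pairSum t (N.segment β.1.1 β.1.1) = ∑ q, if N.blockOf q = β then t q else 0 := by
  refine Finset.sum_congr rfl fun q _ => ?_
  simp only [mem_segment, blockOf, Subtype.ext_iff, Prod.ext_iff]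
  split_ifs <;> first | omega | rfl

/-- The second differences of the planar variables are the sums over the blocks. -/
theorem blockArg_eq {R : Type*} [Field R] [CharZero R] (d : Fin n → R) (t : PointPair n → R)
    (D : ℕ → R) (ξ : ℕ → ℕ → R) (hD : ∀ a, D a = ∑ k ∈ N.segment a a, d k)
    (hξ : ∀ a b, ξ a b = -blockForm (symMatrix d t) (N.segment a b) (N.segment a b))
    (β : N.blocks) :
    blockArg D ξ β = ∑ q, if N.blockOf q = β then t q else 0 := by
  have hle := (N.mem_blocks.mp β.2).2.1
  by_cases h : β.1.1 = β.1.2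
  · rw [blockArg, if_pos h, ← N.pairSum_segment t β h, hD, hξ, blockForm_symMatrix_self]
    ring
  · rw [blockArg, if_neg h, ← N.blockForm_segment d t β h]
    obtain ⟨⟨a, b⟩, hq⟩ := β
    simp only at h hle ⊢
    obtain ⟨b, rfl⟩ : ∃ b', b = b' + 1 := ⟨b - 1, by omega⟩
    have hab : a ≤ b := by omega
    set τ := symMatrix d t
    have hc := blockForm_comm (symMatrix_comm d t)
    simp only [Nat.add_sub_cancel, hξ]
    have e1 : ∀ S, blockForm τ (N.segment a (b + 1)) S = blockForm τ (N.segment a a) S +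
        blockForm τ (N.segment (a + 1) b) S + blockForm τ (N.segment (b + 1) (b + 1)) S := fun S => by
      rw [N.blockForm_split_left (c := a) (by omega) (by omega),
        N.blockForm_split_left (a := a + 1) (c := b) (by omega) (by omega), add_assoc]
    have e2 : ∀ S, blockForm τ (N.segment a b) S = blockForm τ (N.segment a a) S +
        blockForm τ (N.segment (a + 1) b) S := fun S => N.blockForm_split_left (by omega) hab _ _
    have e3 : ∀ S, blockForm τ (N.segment (a + 1) (b + 1)) S = blockForm τ (N.segment (a + 1) b) S +
        blockForm τ (N.segment (b + 1) (b + 1)) S :=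
      fun S => N.blockForm_split_left (by omega) (by omega) _ _
    have f1 : ∀ S, blockForm τ S (N.segment a (b + 1)) = blockForm τ S (N.segment a a) +
        blockForm τ S (N.segment (a + 1) b) + blockForm τ S (N.segment (b + 1) (b + 1)) := fun S => by
      rw [hc, e1, hc _ S, hc _ S, hc _ S]
    have f2 : ∀ S, blockForm τ S (N.segment a b) = blockForm τ S (N.segment a a) +
        blockForm τ S (N.segment (a + 1) b) := fun S => by rw [hc, e2, hc _ S, hc _ S]
    have f3 : ∀ S, blockForm τ S (N.segment (a + 1) (b + 1)) = blockForm τ S (N.segment (a + 1) b) +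
        blockForm τ S (N.segment (b + 1) (b + 1)) := fun S => by rw [hc, e3, hc _ S, hc _ S]
    rw [e1, e2, e3, f1, f1, f1, f2, f2, f3, f3, hc (N.segment (b + 1) (b + 1)) (N.segment a a),
      hc (N.segment (a + 1) b) (N.segment a a),
      hc (N.segment (b + 1) (b + 1)) (N.segment (a + 1) b)]
    ring

/-- The sum of a row of the form over a vertex, in terms of the planar variables. -/
theorem blockForm_vertex {R : Type*} [CommRing R] {τ : Fin n → Fin n → R}
    (hτ : ∀ i j, τ i j = τ j i) (ξ : ℕ → ℕ → R)
    (hξ : ∀ a b, ξ a b = -blockForm τ (N.segment a b) (N.segment a b))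
    {a : ℕ} (ha : 1 ≤ a) (har : a ≤ r) :
    (ξ a r - ξ (a + 1) r) - (ξ 1 (a - 1) - ξ 1 a) =
      -(2 * blockForm τ (N.segment a a) Finset.univ) := by
  obtain ⟨a, rfl⟩ : ∃ a', a = a' + 1 := ⟨a - 1, by omega⟩
  have hc := blockForm_comm hτ
  rw [← N.segment_one_right]
  simp only [Nat.add_sub_cancel, hξ]
  have e1 : ∀ S, blockForm τ (N.segment (a + 1) r) S = blockForm τ (N.segment (a + 1) (a + 1)) S +
      blockForm τ (N.segment (a + 1 + 1) r) S := fun S => N.blockForm_split_left (by omega) har _ _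
  have e2 : ∀ S, blockForm τ (N.segment 1 (a + 1)) S = blockForm τ (N.segment 1 a) S +
      blockForm τ (N.segment (a + 1) (a + 1)) S :=
    fun S => N.blockForm_split_left (by omega) (by omega) _ _
  have e3 : ∀ S, blockForm τ (N.segment 1 r) S = blockForm τ (N.segment 1 a) S +
      blockForm τ (N.segment (a + 1) r) S := fun S =>
    N.blockForm_split_left (by omega) (by omega) _ _
  have f1 : ∀ S, blockForm τ S (N.segment (a + 1) r) = blockForm τ S (N.segment (a + 1) (a + 1)) +
      blockForm τ S (N.segment (a + 1 + 1) r) := fun S => by rw [hc, e1, hc _ S, hc _ S]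
  have f2 : ∀ S, blockForm τ S (N.segment 1 (a + 1)) = blockForm τ S (N.segment 1 a) +
      blockForm τ S (N.segment (a + 1) (a + 1)) := fun S => by rw [hc, e2, hc _ S, hc _ S]
  have f3 : ∀ S, blockForm τ S (N.segment 1 r) = blockForm τ S (N.segment 1 a) +
      blockForm τ S (N.segment (a + 1) r) := fun S => by rw [hc, e3, hc _ S, hc _ S]
  rw [e1, f1, f1, e2, f2, f2, f3, f1, hc (N.segment (a + 1) (a + 1)) (N.segment 1 a),
    hc (N.segment (a + 1 + 1) r) (N.segment (a + 1) (a + 1))]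
  ring

end NecklaceChain

/-! ### The independent Mellin variables and the change of variables -/

section solve

variable {n : ℕ} {R : Type*}

/-- The values on all pairs with sum `T`, given those on all pairs but `e`. -/
def solvePair [AddCommGroup R] (e : Fin n × Fin n) (T : R)
    (y : {q : Fin n × Fin n // q.1 < q.2 ∧ q ≠ e} → R) (q : PointPair n) : R :=
  if hq : q.1 ≠ e then y ⟨q.1, q.2, hq⟩ else T - ∑ q', y q'

/-- The values at all points with sum `T`, given those at all points but `p`. -/
def solvePoint [AddCommGroup R] (p : Fin n) (T : R) (y : {k : Fin n // k ≠ p} → R) (k : Fin n) : R :=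
  if hk : k ≠ p then y ⟨k, hk⟩ else T - ∑ k', y k'

theorem sum_solvePoint [AddCommGroup R] (p : Fin n) (T : R) (y : {k : Fin n // k ≠ p} → R) :
    ∑ k, solvePoint p T y k = T := by
  rw [← Fintype.sum_subtype_add_sum_subtype (fun k => k ≠ p)]
  have h1 : ∀ k : {k // k ≠ p}, solvePoint p T y k = y k := fun k => dif_pos k.2
  have h2 : ∀ k : {k // ¬ k ≠ p}, solvePoint p T y k = T - ∑ k', y k' := fun k => dif_neg k.2
  have h3 : Fintype.card {k // ¬ k ≠ p} = 1 := by simp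
  simp only [h1, h2, Finset.sum_const, Finset.card_univ, h3, one_smul]
  abel

theorem sum_solvePair [AddCommGroup R] {e : Fin n × Fin n} (he : e.1 < e.2) (T : R)
    (y : {q : Fin n × Fin n // q.1 < q.2 ∧ q ≠ e} → R) : ∑ q, solvePair e T y q = T := by
  rw [← Finset.add_sum_erase _ _ (Finset.mem_univ (⟨e, he⟩ : PointPair n))]
  have h1 : solvePair e T y ⟨e, he⟩ = T - ∑ q', y q' := dif_neg (by simp)
  have h2 : ∑ q ∈ Finset.univ.erase (⟨e, he⟩ : PointPair n), solvePair e T y q = ∑ q', y q' := by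
    symm
    refine Finset.sum_bij (fun q _ => ⟨q.1, q.2.1⟩) (fun q _ => ?_) (fun q _ q' _ h => ?_)
      (fun q hq => ?_) (fun q _ => ?_)
    · simp only [Finset.mem_erase, Finset.mem_univ, and_true]
      exact fun h => q.2.2 (congrArg Subtype.val h)
    · exact Subtype.ext (congrArg (fun q : PointPair n => q.1) h)
    · simp only [Finset.mem_erase, Finset.mem_univ, and_true] at hq
      exact ⟨⟨q.1, q.2, fun h => hq (Subtype.ext h)⟩, Finset.mem_univ _, rfl⟩
    · rw [solvePair, dif_pos q.2.2]
  rw [h1, h2]; abel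

theorem solvePair_add_mul_I (e : Fin n × Fin n) (T : ℂ)
    (y : {q : Fin n × Fin n // q.1 < q.2 ∧ q ≠ e} → ℂ)
    (x : {q : Fin n × Fin n // q.1 < q.2 ∧ q ≠ e} → ℝ) (q : PointPair n) :
    solvePair e T (fun v => y v + x v * Complex.I) q =
      solvePair e T y q + solvePair e 0 x q * Complex.I := by
  unfold solvePair
  split_ifs
  · rfl
  · push_cast [Finset.sum_add_distrib, ← Finset.sum_mul]; ring

theorem solvePoint_add_mul_I (p : Fin n) (T : ℂ) (y : {k : Fin n // k ≠ p} → ℂ)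
    (x : {k : Fin n // k ≠ p} → ℝ) (k : Fin n) :
    solvePoint p T (fun v => y v + x v * Complex.I) k =
      solvePoint p T y k + solvePoint p 0 x k * Complex.I := by
  unfold solvePoint
  split_ifs
  · rfl
  · push_cast [Finset.sum_add_distrib, ← Finset.sum_mul]; ring

end solve

/-- The imaginary parts of all `τ_{ij}`, relative to the base point of the contour. -/
def loopPair {n : ℕ} {e : Fin n × Fin n} {p : Fin n} :
    (IndepVar e p → ℝ) →ₗ[ℝ] (PointPair n → ℝ) where
  toFun x := solvePair e 0 fun q => x (Sum.inl q)
  map_add' x y := by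
    ext q
    simp only [solvePair, Pi.add_apply]
    split_ifs
    · rfl
    · rw [Finset.sum_add_distrib]; ring
  map_smul' c x := by
    ext q
    simp only [solvePair, Pi.smul_apply, smul_eq_mul, RingHom.id_apply]
    split_ifs
    · rfl
    · rw [← Finset.mul_sum]; ring

/-- The imaginary parts of all `τ_{k,n+1}`, relative to the base point of the contour. -/
def loopPoint {n : ℕ} {e : Fin n × Fin n} {p : Fin n} :
    (IndepVar e p → ℝ) →ₗ[ℝ] (Fin n → ℝ) where
  toFun x := solvePoint p 0 fun k => x (Sum.inr k)
  map_add' x y := by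
    ext q
    simp only [solvePoint, Pi.add_apply]
    split_ifs
    · rfl
    · rw [Finset.sum_add_distrib]; ring
  map_smul' c x := by
    ext q
    simp only [solvePoint, Pi.smul_apply, smul_eq_mul, RingHom.id_apply]
    split_ifs
    · rfl
    · rw [← Finset.mul_sum]; ring

theorem pairSum_add {n : ℕ} {R : Type*} [AddCommMonoid R] (t t' : PointPair n → R)
    (S : Finset (Fin n)) : pairSum (t + t') S = pairSum t S + pairSum t' S := by
  simp only [pairSum, ← Finset.sum_add_distrib]
  refine Finset.sum_congr rfl fun q _ => ?_
  split_ifs <;> simp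

theorem pairSum_smul {n : ℕ} (c : ℝ) (t : PointPair n → ℝ)
    (S : Finset (Fin n)) : pairSum (c • t) S = c * pairSum t S := by
  simp only [pairSum, Finset.mul_sum]
  refine Finset.sum_congr rfl fun q _ => ?_
  split_ifs <;> simp

theorem pairSum_mem {n : ℕ} {t : PointPair n → ℝ} {A : AddSubgroup ℝ} (h : ∀ q, t q ∈ A)
    (S : Finset (Fin n)) : pairSum t S ∈ A :=
  sum_mem fun q _ => by split_ifs <;> simp [h, zero_mem]

theorem pairSum_univ {n : ℕ} {R : Type*} [AddCommMonoid R] (t : PointPair n → R) :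
    pairSum t Finset.univ = ∑ q, t q := by
  simp [pairSum]

/-- The value at the representative of a fibre is determined by the sum over the fibre and the
values at its other elements. -/
theorem mem_of_fibre_sums {ι κ : Type*} [Fintype ι] [DecidableEq ι] [DecidableEq κ] (π : ι → κ)
    (ρ : κ → ι) (A : AddSubgroup ℝ) {t : ι → ℝ} (hsum : ∀ b, (∑ i, if π i = b then t i else 0) ∈ A)
    (hfree : ∀ i, ρ (π i) ≠ i → t i ∈ A) (i : ι) : t i ∈ A := by
  by_cases h : ρ (π i) = i
  · have h1 := hsum (π i)
    rw [← Finset.add_sum_erase _ _ (Finset.mem_univ i), if_pos rfl] at h1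
    refine (add_mem_cancel_right (sum_mem fun j hj => ?_)).mp h1
    split_ifs with hij
    · exact hfree j (by rw [hij, h]; exact (Finset.ne_of_mem_erase hj).symm)
    · exact zero_mem _
  · exact hfree i h

namespace NecklaceChain

variable {n r : ℕ} (N : NecklaceChain n r)

section solution

variable (e : Fin n × Fin n) (p : Fin n) (z : IndepVar e p → ℂ)

theorem solve_inner : (N.solve e p z).inner = symMatrix N.Δ
    (solvePair e ((∑ k, N.Δ k) / 2 - N.h) fun q => z (Sum.inl q)) := by
  ext i j
  simp only [solve, symMatrix, solvePair]
  split_ifs <;> first | rfl | (exfalso; tauto)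

theorem sum_solve_right : ∑ k, (N.solve e p z).right k = N.h + N.c :=
  sum_solvePoint p _ _

theorem solve_left_add_right (k : Fin n) :
    (N.solve e p z).left k + (N.solve e p z).right k = -∑ j, (N.solve e p z).inner k j := by
  have h : ∑ j, (N.solve e p z).inner k j =
      -N.Δ k + ∑ j ∈ Finset.univ.filter (fun j => j ≠ k), (N.solve e p z).inner k j := by
    rw [Finset.filter_ne', ← Finset.add_sum_erase _ _ (Finset.mem_univ k)]
    congr 1
    rw [solve_inner, symMatrix_self]
  rw [h]
  simp only [solve]
  ring

end solution

theorem mandelstam_symMatrix (t : PointPair n → ℂ) (S : Finset (Fin n)) :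
    N.mandelstam S (symMatrix N.Δ t) = ∑ k ∈ S, N.Δ k - 2 * pairSum t S := by
  have h : pairSum t S = ∑ q : PointPair n, if q.1.1 ∈ S ∧ q.1.2 ∈ S then
      symMatrix N.Δ t q.1.1 q.1.2 else 0 := by simp only [symMatrix_lt]; rfl
  rw [mandelstam, h, sum_pointPair fun i j => if i ∈ S ∧ j ∈ S then symMatrix N.Δ t i j else 0,
    ← Finset.sum_subset (Finset.subset_univ S)]
  · congr 2
    refine Finset.sum_congr rfl fun i hi => ?_
    rw [Finset.sum_filter, ← Finset.sum_subset (Finset.subset_univ S)]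
    · refine Finset.sum_congr rfl fun j hj => ?_
      simp [hi, hj]
    · intro j _ hj; simp [hj]
  · intro i _ hi; simp [hi]

theorem planar_symMatrix (t : PointPair n → ℂ) (a b : ℕ) :
    N.planar (symMatrix N.Δ t) a b =
      -blockForm (symMatrix N.Δ t) (N.segment a b) (N.segment a b) := by
  rw [planar, mandelstam_symMatrix, blockForm_symMatrix_self]; ring

section contour

variable {e : Fin n × Fin n} {p : Fin n} (σ : IndepVar e p → ℝ) (x : IndepVar e p → ℝ)

/-- The point of the contour that corresponds to `x`. -/
noncomputable def contourPoint : LoopMellinPoint n := N.solve e p (upwardLine σ x)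

theorem contourPoint_zero : N.contourPoint σ 0 = N.solve e p fun v => (σ v : ℂ) := by
  rw [contourPoint]
  congr 1
  ext v
  simp [upwardLine]

theorem contourPoint_inner : (N.contourPoint σ x).inner = symMatrix N.Δ (fun q =>
    (N.contourPoint σ 0).inner q.1.1 q.1.2 + loopPair x q * Complex.I) := by
  rw [contourPoint_zero, contourPoint, solve_inner]
  congr 1
  ext q
  rw [solve_inner, symMatrix_lt]
  exact solvePair_add_mul_I e _ _ _ q

theorem contourPoint_zero_inner : (N.contourPoint σ 0).inner =
    symMatrix N.Δ fun q => (N.contourPoint σ 0).inner q.1.1 q.1.2 := by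
  rw [N.contourPoint_inner σ 0]
  simp [symMatrix_lt]

theorem contourPoint_inner_apply (q : PointPair n) : (N.contourPoint σ x).inner q.1.1 q.1.2 =
    (N.contourPoint σ 0).inner q.1.1 q.1.2 + loopPair x q * Complex.I := by
  rw [contourPoint_inner, symMatrix_lt]

theorem contourPoint_right (k : Fin n) : (N.contourPoint σ x).right k =
    (N.contourPoint σ 0).right k + loopPoint x k * Complex.I := by
  rw [contourPoint_zero]
  exact solvePoint_add_mul_I p _ _ _ k

theorem planar_contourPoint (a b : ℕ) : N.planar (N.contourPoint σ x).inner a b =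
    N.planar (N.contourPoint σ 0).inner a b -
      (2 * pairSum (loopPair x) (N.segment a b) : ℝ) * Complex.I := by
  rw [N.contourPoint_inner σ x]
  conv_rhs => rw [contourPoint_zero_inner]
  rw [planar, planar, mandelstam_symMatrix, mandelstam_symMatrix]
  simp only [pairSum]
  push_cast
  have : ∀ q : PointPair n, (if q.1.1 ∈ N.segment a b ∧ q.1.2 ∈ N.segment a b then
      (N.contourPoint σ 0).inner q.1.1 q.1.2 + loopPair x q * Complex.I else 0) =
      (if q.1.1 ∈ N.segment a b ∧ q.1.2 ∈ N.segment a b then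
        (N.contourPoint σ 0).inner q.1.1 q.1.2 else 0) +
      ((if q.1.1 ∈ N.segment a b ∧ q.1.2 ∈ N.segment a b then loopPair x q else 0 : ℝ) : ℂ) *
        Complex.I := fun q => by split_ifs <;> simp
  simp only [this, Finset.sum_add_distrib, ← Finset.sum_mul]
  ring

theorem chainMandelstam_contourPoint (a : ℕ) : N.chainMandelstam (N.contourPoint σ x) a =
    N.chainMandelstam (N.contourPoint σ 0) a -
      (2 * (pairSum (loopPair x) (N.segment a r) + ∑ k ∈ N.segment a r, loopPoint x k) : ℝ) *
        Complex.I := by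
  have h := N.planar_contourPoint σ x a r
  rw [planar, planar] at h
  rw [chainMandelstam, chainMandelstam, h]
  simp only [N.contourPoint_right σ x, Finset.sum_add_distrib, ← Finset.sum_mul]
  push_cast
  ring

end contour

/-- A representative of each channel of `K₁`. -/
noncomputable def pairRep : N.blocks → PointPair n := Function.surjInv N.blockOf_surjective

theorem blockOf_pairRep (β : N.blocks) : N.blockOf (N.pairRep β) = β :=
  Function.surjInv_eq N.blockOf_surjective β

/-- A boundary point of each vertex. -/
noncomputable def vertexRep : Fin r → Fin n := Function.surjInv N.vertex_surjective

theorem vertex_vertexRep (a : Fin r) : N.vertex (N.vertexRep a) = a :=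
  Function.surjInv_eq N.vertex_surjective a

/-- The pairs whose Mellin variables are integrated out. -/
abbrev FibrePair : Type := {q : PointPair n // N.pairRep (N.blockOf q) ≠ q}

/-- The points `k` whose Mellin variables `τ_{k,n+1}` are integrated out. -/
abbrev FibrePoint : Type := {k : Fin n // N.vertexRep (N.vertex k) ≠ k}

/-- Minus one half of the imaginary parts of `Ξ` and `ξ`, relative to the base point. -/
def reducedPart {e : Fin n × Fin n} {p : Fin n} :
    (IndepVar e p → ℝ) →ₗ[ℝ] (N.ReducedVar → ℝ) where
  toFun x := Sum.elim
    (fun a => pairSum (loopPair x) (N.segment a r) + ∑ k ∈ N.segment a r, loopPoint x k)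
    (fun q => pairSum (loopPair x) (N.segment q.1.1 q.1.2))
  map_add' x y := by
    ext (a | q)
    · simp only [map_add, pairSum_add, Sum.elim_inl, Pi.add_apply, Finset.sum_add_distrib]; ring
    · simp only [map_add, pairSum_add, Sum.elim_inr, Pi.add_apply]
  map_smul' c x := by
    ext (a | q)
    · simp only [map_smul, pairSum_smul, Sum.elim_inl, Pi.smul_apply, smul_eq_mul,
        ← Finset.mul_sum, RingHom.id_apply]; ring
    · simp only [map_smul, pairSum_smul, Sum.elim_inr, Pi.smul_apply, smul_eq_mul,
        RingHom.id_apply]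

/-- The change of variables of the reduction. -/
def reduction {e : Fin n × Fin n} {p : Fin n} :
    (IndepVar e p → ℝ) →ₗ[ℝ] (N.ReducedVar ⊕ (N.FibrePair ⊕ N.FibrePoint) → ℝ) where
  toFun x := Sum.elim (N.reducedPart x)
    (Sum.elim (fun u => loopPair x u) (fun v => loopPoint x v))
  map_add' x y := by ext (a | a | a) <;> simp
  map_smul' c x := by ext (a | a | a) <;> simp

theorem sum_loopPair {e : Fin n × Fin n} (he : e.1 < e.2) {p : Fin n} (x : IndepVar e p → ℝ) :
    ∑ q, loopPair x q = 0 := sum_solvePair he _ _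

theorem sum_loopPoint {e : Fin n × Fin n} {p : Fin n} (x : IndepVar e p → ℝ) :
    ∑ q, loopPoint x q = 0 := sum_solvePoint _ _ _

theorem pairSum_segment_mem (A : AddSubgroup ℝ) {t : PointPair n → ℝ} (h0 : ∑ q, t q = 0)
    (h : ∀ q ∈ N.freeChannels, pairSum t (N.segment q.1 q.2) ∈ A) {a b : ℕ} (ha : 1 ≤ a)
    (hb : b ≤ r) : pairSum t (N.segment a b) ∈ A := by
  by_cases hab : (a, b) ∈ N.blocks
  · by_cases h1 : (a, b) = (1, r)
    · simp only [Prod.mk.injEq] at h1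
      rw [h1.1, h1.2, N.segment_one_right, pairSum_univ, h0]
      exact zero_mem _
    · exact h (a, b) (by rw [freeChannels_eq, Finset.mem_erase]; exact ⟨h1, hab⟩)
  · have : pairSum t (N.segment a b) = 0 := by
      refine Finset.sum_eq_zero fun q _ => if_neg ?_
      rintro ⟨h1, h2⟩
      refine hab (N.mem_blocks.mpr ⟨ha, ?_, hb, fun h => ne_of_gt ?_⟩)
      · rw [mem_segment] at h1; simp only; omega
      · simp only at h ⊢
        subst h
        exact Finset.one_lt_card.mpr ⟨_, h1, _, h2, q.2.ne⟩
    rw [this]; exact zero_mem _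

theorem pair_mem (A : AddSubgroup ℝ) {t : PointPair n → ℝ} (h0 : ∑ q, t q = 0)
    (h : ∀ q ∈ N.freeChannels, pairSum t (N.segment q.1 q.2) ∈ A)
    (hfree : ∀ q : N.FibrePair, t q ∈ A) (q : PointPair n) : t q ∈ A := by
  refine mem_of_fibre_sums N.blockOf N.pairRep A (fun β => ?_) (fun q hq => hfree ⟨q, hq⟩) q
  obtain ⟨h1, h2, h3, -⟩ := N.mem_blocks.mp β.2
  have hmem := fun {a b : ℕ} => N.pairSum_segment_mem A h0 h (a := a) (b := b)
  rw [← N.blockArg_eq (fun _ => (0 : ℝ)) t (fun _ => 0)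
    (fun a b => -(2 * pairSum t (N.segment a b))) (by simp)
    (fun a b => by rw [blockForm_symMatrix_self]; simp), blockArg]
  split_ifs with hab
  · have := hmem h1 (hab.trans_le h3)
    convert this using 1; ring
  · have := sub_mem (add_mem (hmem (b := β.1.2 - 1) (h1.trans (Nat.le_succ _)) (by omega))
      (hmem h1 h3)) (add_mem (hmem (b := β.1.2 - 1) h1 (by omega)) (hmem (h1.trans (Nat.le_succ _)) h3))
    convert this using 1; ring

theorem sum_vertex {R : Type*} [AddCommMonoid R] (f : Fin n → R) (a : Fin r) :
    (∑ k, if N.vertex k = a then f k else 0) = ∑ k ∈ N.segment (a + 1) (a + 1), f k := by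
  rw [← Finset.sum_filter]
  refine Finset.sum_congr ?_ fun _ _ => rfl
  ext k
  simp only [Finset.mem_filter, Finset.mem_univ, true_and, mem_segment, Fin.ext_iff]
  omega

theorem point_mem (A : AddSubgroup ℝ) {t : Fin n → ℝ} (h0 : ∑ k, t k = 0)
    (h : ∀ a ∈ Finset.Icc 2 r, ∑ k ∈ N.segment a r, t k ∈ A)
    (hfree : ∀ k : N.FibrePoint, t k ∈ A) (k : Fin n) : t k ∈ A := by
  refine mem_of_fibre_sums N.vertex N.vertexRep A (fun a => ?_) (fun q hq => hfree ⟨q, hq⟩) k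
  have hmem : ∀ a, 1 ≤ a → ∑ k ∈ N.segment a r, t k ∈ A := fun a ha => by
    rcases ha.eq_or_lt with rfl | ha
    · rw [N.segment_one_right, h0]; exact zero_mem _
    · by_cases har : a ≤ r
      · exact h a (Finset.mem_Icc.mpr ⟨ha, har⟩)
      · rw [N.segment_eq_empty (by omega), Finset.sum_empty]; exact zero_mem _
  rw [N.sum_vertex]
  have h1 := N.sum_segment_split (a := a + 1) (c := a + 1) (b := r) (by omega) a.2 t
  rw [eq_sub_of_add_eq h1.symm]
  exact sub_mem (hmem _ (by omega)) (hmem _ (by omega))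

theorem reduction_mem_iff {e : Fin n × Fin n} (he : e.1 < e.2) {p : Fin n}
    (x : IndepVar e p → ℝ) :
    (∀ j, N.reduction x j ∈ integerSubring ℝ) ↔ ∀ i, x i ∈ integerSubring ℝ := by
  set A := (integerSubring ℝ).toAddSubgroup
  constructor
  · intro h
    have h1 : ∀ q, loopPair x q ∈ A := N.pair_mem A (sum_loopPair he x)
      (fun q hq => h (Sum.inl (Sum.inr ⟨q, hq⟩))) fun q => h (Sum.inr (Sum.inl q))
    have h2 : ∀ k, loopPoint x k ∈ A := N.point_mem A (sum_loopPoint x)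
      (fun a ha => (add_mem_cancel_left (pairSum_mem h1 (N.segment a r))).mp
        (h (Sum.inl (Sum.inl ⟨a, ha⟩)))) fun k => h (Sum.inr (Sum.inr k))
    rintro (q | k)
    · have := h1 ⟨q.1, q.2.1⟩
      have e1 : loopPair x ⟨q.1, q.2.1⟩ = x (Sum.inl q) := dif_pos q.2.2
      rwa [e1] at this
    · have := h2 k
      have e1 : loopPoint x k = x (Sum.inr k) := dif_pos k.2
      rwa [e1] at this
  · intro h
    have h1 : ∀ q, loopPair x q ∈ A := fun q => by
      change solvePair e 0 (fun q => x (Sum.inl q)) q ∈ A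
      unfold solvePair
      split_ifs
      · exact h _
      · exact sub_mem (zero_mem _) (sum_mem fun _ _ => h _)
    have h2 : ∀ q, loopPoint x q ∈ A := fun q => by
      change solvePoint p 0 (fun q => x (Sum.inr q)) q ∈ A
      unfold solvePoint
      split_ifs
      · exact h _
      · exact sub_mem (zero_mem _) (sum_mem fun _ _ => h _)
    rintro ((a | q) | (q | k))
    · exact add_mem (pairSum_mem (A := A) h1 _) (sum_mem fun k _ => h2 k)
    · exact pairSum_mem (A := A) h1 _
    · exact h1 q
    · exact h2 k

theorem card_fibre {ι κ : Type*} [Fintype ι] [Fintype κ] [DecidableEq ι] (π : ι → κ) (ρ : κ → ι)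
    (hρ : ∀ b, π (ρ b) = b) :
    Fintype.card {i // ρ (π i) ≠ i} + Fintype.card κ = Fintype.card ι := by
  have R : κ ≃ {i // ρ (π i) = i} :=
    { toFun := fun b => ⟨ρ b, by simp [hρ]⟩
      invFun := fun i => π i
      left_inv := fun b => hρ b
      right_inv := fun i => Subtype.ext i.2 }
  have h1 := Fintype.card_subtype_le (fun i => ρ (π i) = i)
  have h2 : Fintype.card {i // ρ (π i) ≠ i} =
      Fintype.card ι - Fintype.card {i // ρ (π i) = i} := by
    convert Fintype.card_subtype_compl (fun i => ρ (π i) = i)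
  rw [Fintype.card_congr R]
  omega

theorem card_indepVar {e : Fin n × Fin n} (he : e.1 < e.2) (p : Fin n) :
    Fintype.card (IndepVar e p) =
      Fintype.card (N.ReducedVar ⊕ (N.FibrePair ⊕ N.FibrePoint)) := by
  have h1 : Fintype.card N.FibrePair + Fintype.card N.blocks = Fintype.card (PointPair n) :=
    card_fibre N.blockOf N.pairRep N.blockOf_pairRep
  have h2 : Fintype.card N.FibrePoint + Fintype.card (Fin r) = Fintype.card (Fin n) :=
    card_fibre N.vertex N.vertexRep N.vertex_vertexRep
  have h3 : Fintype.card {q : Fin n × Fin n // q.1 < q.2 ∧ q ≠ e} + 1 =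
      Fintype.card (PointPair n) := by
    rw [Fintype.card_subtype, Fintype.card_subtype, ← Finset.card_erase_add_one
      (a := e) (s := Finset.univ.filter fun q : Fin n × Fin n => q.1 < q.2) (by simp [he])]
    congr 2
    ext q; simp [and_comm]
  have h4 : Fintype.card {k : Fin n // k ≠ p} + 1 = n := by
    have := (Fin.pos p)
    rw [Fintype.card_subtype_compl, Fintype.card_fin, Fintype.card_subtype_eq]; omega
  have hr : 1 ≤ r := (N.vertex p).pos
  have h5 : Fintype.card N.blocks = Fintype.card N.freeChannels + 1 := by
    have hmem : (1, r) ∈ N.blocks := by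
      rw [mem_blocks]
      refine ⟨le_rfl, hr, le_rfl, fun h => ?_⟩
      simp only at h ⊢
      subst h
      rw [N.segment_one_right, Finset.card_univ, Fintype.card_fin]
      have := e.2.2; have := e.1.2; rw [Fin.lt_def] at he; omega
    rw [Fintype.card_coe, Fintype.card_coe, freeChannels_eq, Finset.card_erase_add_one hmem]
  rw [Fintype.card_fin, Fintype.card_fin] at h2
  have h6 : Fintype.card (Finset.Icc 2 r) = r - 1 := by
    rw [Fintype.card_coe, Nat.card_Icc]; omega
  rw [Fintype.card_sum, Fintype.card_sum, Fintype.card_sum, Fintype.card_sum, h6]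
  omega

end NecklaceChain

/-! ### The reduced kernel -/

theorem prod_Icc_one_eq_prod_fin {M : Type*} [CommMonoid M] (r : ℕ) (f : ℕ → M) :
    ∏ a ∈ Finset.Icc 1 r, f a = ∏ a : Fin r, f (a + 1) := by
  rw [Fin.prod_univ_eq_prod_range (fun a => f (a + 1)), Finset.range_eq_Ico,
    Finset.prod_Ico_add' f 0 r 1, zero_add]
  rfl

namespace NecklaceChain

variable {n r : ℕ} (N : NecklaceChain n r)

theorem preKernel_eq {e : Fin n × Fin n} {p : Fin n} (z : IndepVar e p → ℂ)
    (δ : Fin n → Fin n → ℂ) :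
    preKernel (N.solve e p z) δ =
      (∏ k, betaB ((N.solve e p z).right k) (-∑ j, (N.solve e p z).inner k j)) *
        ∏ q : PointPair n, betaB ((N.solve e p z).inner q.1.1 q.1.2) (δ q.1.1 q.1.2) := by
  rw [preKernel]
  congr 1
  · refine Finset.prod_congr rfl fun k _ => ?_
    rw [← N.solve_left_add_right, betaB, add_sub_cancel_right]
    ring
  · rw [prod_pointPair fun i j => betaB ((N.solve e p z).inner i j) (δ i j)]
    refine Finset.prod_congr rfl fun i _ => ?_
    rw [← Finset.prod_filter]
    refine Finset.prod_congr ?_ fun j _ => rfl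
    ext j; simp

theorem kernelOne_eq_prod_blocks (ξ s : ℕ → ℕ → ℂ) :
    N.kernelOne ξ s =
      ∏ β : N.blocks, betaB (blockArg N.vertexDim ξ β) (blockArg N.vertexDim s β) := by
  rw [Finset.prod_coe_sort N.blocks
    fun β => betaB (blockArg N.vertexDim ξ β) (blockArg N.vertexDim s β), kernelOne]
  have h : N.blocks = ((Finset.Icc 1 r) ×ˢ (Finset.Icc 1 r)).filter (· ∈ N.blocks) := by
    ext q
    simp only [Finset.mem_filter, Finset.mem_product, Finset.mem_Icc, mem_blocks]
    omega
  rw [h, Finset.prod_filter, Finset.prod_filter, Finset.prod_product, ← Finset.prod_mul_distrib]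
  refine Finset.prod_congr rfl fun a ha => ?_
  rw [Finset.mem_Icc] at ha
  have h2 : ∏ b ∈ Finset.Icc a r, (if (a, b) ∈ N.blocks then
      betaB (blockArg N.vertexDim ξ (a, b)) (blockArg N.vertexDim s (a, b)) else 1) =
      ∏ b ∈ Finset.Icc 1 r, (if (a, b) ∈ N.blocks then
      betaB (blockArg N.vertexDim ξ (a, b)) (blockArg N.vertexDim s (a, b)) else 1) := by
    refine Finset.prod_subset (Finset.Icc_subset_Icc_left ha.1) fun b _ hb => if_neg ?_
    rw [Finset.mem_Icc] at hb
    rw [mem_blocks]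
    simp only
    omega
  rw [← h2, ← Finset.Ioc_insert_left ha.2, Finset.prod_insert Finset.left_notMem_Ioc]
  congr 1
  · have : (a, a) ∈ N.blocks ↔ (N.segment a a).card ≠ 1 := by
      rw [mem_blocks]
      exact ⟨fun h => h.2.2.2 rfl, fun h => ⟨ha.1, le_rfl, ha.2, fun _ => h⟩⟩
    simp only [this, blockArg, if_true]
  · refine Finset.prod_congr rfl fun b hb => ?_
    rw [Finset.mem_Ioc] at hb
    rw [if_pos (N.mem_blocks.mpr ⟨ha.1, hb.1.le, hb.2, fun h => absurd h hb.1.ne⟩), blockArg,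
      if_neg hb.1.ne, blockArg, if_neg hb.1.ne]

theorem symMatrix_of_isCanonical {δ : Fin n → Fin n → ℂ} (hδ : N.IsCanonical δ) :
    symMatrix N.Δ (fun q => δ q.1.1 q.1.2) = δ := by
  ext i j
  rw [symMatrix]
  split_ifs with h1 h2
  · rfl
  · exact hδ.1 j i
  · obtain rfl : i = j := le_antisymm (not_lt.mp h2) (not_lt.mp h1)
    exact (hδ.2.1 i).symm

theorem blockArg_planar (t : PointPair n → ℂ) (β : N.blocks) :
    blockArg N.vertexDim (N.planar (symMatrix N.Δ t)) β =
      ∑ q, if N.blockOf q = β then t q else 0 :=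
  N.blockArg_eq N.Δ t _ _ (fun _ => rfl) (N.planar_symMatrix t) β

section solution

variable {e : Fin n × Fin n} {p : Fin n} (z : IndepVar e p → ℂ)

theorem blockArg_solve (β : N.blocks) :
    blockArg N.vertexDim (N.planar (N.solve e p z).inner) β =
      ∑ q : PointPair n, if N.blockOf q = β then (N.solve e p z).inner q.1.1 q.1.2 else 0 := by
  rw [solve_inner, blockArg_planar]
  simp only [symMatrix_lt]

theorem planar_one_right (he : e.1 < e.2) :
    N.planar (N.solve e p z).inner 1 r = 2 * N.h := by
  rw [solve_inner, planar, mandelstam_symMatrix, segment_one_right, pairSum_univ,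
    sum_solvePair he]
  ring

theorem planar_of_lt {τ : Fin n → Fin n → ℂ} {a b : ℕ} (h : b < a) : N.planar τ a b = 0 := by
  simp [planar, N.segment_eq_empty h, mandelstam]

theorem planar_of_card_eq_one {a : ℕ} (h : (N.segment a a).card = 1) (τ : Fin n → Fin n → ℂ) :
    N.planar τ a a = N.vertexDim a := by
  obtain ⟨k, hk⟩ := Finset.card_eq_one.mp h
  simp [planar, vertexDim, mandelstam, hk, Finset.filter_singleton]

theorem chainMandelstam_one (he : e.1 < e.2) :
    N.chainMandelstam (N.solve e p z) 1 = N.h - N.c := by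
  have h := N.planar_one_right z he
  rw [planar] at h
  rw [chainMandelstam, h, segment_one_right, sum_solve_right]
  ring

theorem chainMandelstam_succ (τ : LoopMellinPoint n) :
    N.chainMandelstam τ (r + 1) = N.h + N.c := by
  simp [chainMandelstam, N.segment_eq_empty (Nat.lt_succ_self r), mandelstam]

/-- The values of the reduced variables on the Mellin variables `τ`. -/
noncomputable def reducedPoint (τ : LoopMellinPoint n) : N.ReducedVar → ℂ :=
  Sum.elim (fun a => N.chainMandelstam τ a) (fun q => N.planar τ.inner q.1.1 q.1.2)

theorem fullPlanar_reducedPoint (he : e.1 < e.2) {a b : ℕ} (ha : 1 ≤ a) (hb : b ≤ r) :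
    N.fullPlanar (N.reducedPoint (N.solve e p z)) a b = N.planar (N.solve e p z).inner a b := by
  rw [fullPlanar]
  split_ifs with h1 h2 h3
  · rfl
  · simp only [Prod.mk.injEq] at h2
    rw [h2.1, h2.2, N.planar_one_right z he]
  · subst h3
    refine (N.planar_of_card_eq_one ?_ _).symm
    by_contra hc
    exact h1 (by
      rw [freeChannels_eq, Finset.mem_erase, mem_blocks]
      exact ⟨h2, ha, le_rfl, hb, fun _ => hc⟩)
  · refine (N.planar_of_lt ?_).symm
    by_contra hc
    exact h1 (by
      rw [freeChannels_eq, Finset.mem_erase, mem_blocks]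
      exact ⟨h2, ha, not_lt.mp hc, hb, fun h => absurd h h3⟩)

theorem fullChain_reducedPoint (he : e.1 < e.2) {a : ℕ} (ha : 1 ≤ a) (har : a ≤ r + 1) :
    N.fullChain (N.reducedPoint (N.solve e p z)) a = N.chainMandelstam (N.solve e p z) a := by
  rw [fullChain]
  split_ifs with h1 h2
  · rfl
  · obtain rfl : a = 1 := by omega
    rw [N.chainMandelstam_one z he]
  · rw [Finset.mem_Icc] at h1
    obtain rfl : a = r + 1 := by omega
    rw [N.chainMandelstam_succ]

theorem kernelOne_reducedPoint (he : e.1 < e.2) {δ : Fin n → Fin n → ℂ} (hδ : N.IsCanonical δ) :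
    N.kernelOne (N.fullPlanar (N.reducedPoint (N.solve e p z))) (N.planar δ) =
      ∏ β : N.blocks, betaB
        (∑ q : PointPair n, if N.blockOf q = β then (N.solve e p z).inner q.1.1 q.1.2 else 0)
        (∑ q : PointPair n, if N.blockOf q = β then δ q.1.1 q.1.2 else 0) := by
  rw [kernelOne_eq_prod_blocks]
  refine Finset.prod_congr rfl fun β _ => ?_
  have hs := N.blockArg_planar (fun q => δ q.1.1 q.1.2) β
  rw [N.symMatrix_of_isCanonical hδ] at hs
  rw [hs, ← blockArg_solve]
  congr 1
  obtain ⟨h1, h2, h3, -⟩ := N.mem_blocks.mp β.2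
  have h : ∀ {a b}, 1 ≤ a → b ≤ r → _ := fun {a b} => N.fullPlanar_reducedPoint z he (a := a) (b := b)
  unfold blockArg
  rw [h h1 (h2.trans h3), h h1 (by omega), h (by omega) h3, h (by omega) (by omega), h h1 h3]

/-- The sum of the `τ_{k,n+1}` over a vertex. -/
theorem sum_right_vertex (he : e.1 < e.2) (a : Fin r) :
    (∑ k, if N.vertex k = a then (N.solve e p z).right k else 0) =
      ((N.fullPlanar (N.reducedPoint (N.solve e p z)) (a + 1) r -
        N.fullPlanar (N.reducedPoint (N.solve e p z)) (a + 1 + 1) r) -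
        (N.fullChain (N.reducedPoint (N.solve e p z)) (a + 1) -
          N.fullChain (N.reducedPoint (N.solve e p z)) (a + 1 + 1))) / 2 := by
  have ha := a.2
  rw [N.fullPlanar_reducedPoint z he (by omega) le_rfl,
    N.fullPlanar_reducedPoint z he (by omega) le_rfl,
    N.fullChain_reducedPoint z he (by omega) (by omega),
    N.fullChain_reducedPoint z he (by omega) (by omega), sum_vertex, chainMandelstam,
    chainMandelstam, planar, planar,
    N.sum_segment_split (a := a + 1) (c := a + 1) (b := r) (by omega) (by omega)]
  ring

/-- The sum of the `τ_{0k} + τ_{k,n+1}` over a vertex. -/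
theorem sum_row_vertex (he : e.1 < e.2) (a : Fin r) :
    (∑ k, if N.vertex k = a then -∑ j, (N.solve e p z).inner k j else 0) =
      ((N.fullPlanar (N.reducedPoint (N.solve e p z)) (a + 1) r -
        N.fullPlanar (N.reducedPoint (N.solve e p z)) (a + 1 + 1) r) -
        (N.fullPlanar (N.reducedPoint (N.solve e p z)) 1 a -
          N.fullPlanar (N.reducedPoint (N.solve e p z)) 1 (a + 1))) / 2 := by
  have ha := a.2
  rw [N.fullPlanar_reducedPoint z he (by omega) le_rfl,
    N.fullPlanar_reducedPoint z he (by omega) le_rfl,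
    N.fullPlanar_reducedPoint z he le_rfl (by omega),
    N.fullPlanar_reducedPoint z he le_rfl (by omega), sum_vertex]
  have h := N.blockForm_vertex (τ := (N.solve e p z).inner)
    (by rw [solve_inner]; exact symMatrix_comm _ _) (N.planar (N.solve e p z).inner)
    (by rw [solve_inner]; exact N.planar_symMatrix _) (a := a + 1) (by omega) (by omega)
  rw [Nat.add_sub_cancel] at h
  rw [h, blockForm, Finset.sum_neg_distrib]
  ring

theorem kernelTwo_reducedPoint (he : e.1 < e.2) :
    kernelTwo (r := r) (N.fullChain (N.reducedPoint (N.solve e p z)))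
        (N.fullPlanar (N.reducedPoint (N.solve e p z))) =
      ∏ a : Fin r, betaB (∑ k, if N.vertex k = a then (N.solve e p z).right k else 0)
        (∑ k, if N.vertex k = a then -∑ j, (N.solve e p z).inner k j else 0) := by
  rw [kernelTwo, prod_Icc_one_eq_prod_fin]
  refine Finset.prod_congr rfl fun a _ => ?_
  rw [N.sum_right_vertex z he, N.sum_row_vertex z he, betaB, Nat.add_sub_cancel]
  congr 3
  ring

end solution

end NecklaceChain

/-! ### Reduction of the loop integral -/

namespace NecklaceChain

variable {n r : ℕ} (N : NecklaceChain n r)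

/-- The independent Mellin variables, as a product of the reduced ones and those of the fibres. -/
theorem exists_measurePreserving_reduction {e : Fin n × Fin n} (he : e.1 < e.2) (p : Fin n) :
    ∃ ψ : (N.ReducedVar → ℝ) × ((N.FibrePair → ℝ) × (N.FibrePoint → ℝ)) ≃ᵐ (IndepVar e p → ℝ),
      MeasurePreserving ψ ∧ ∀ y, N.reducedPart (ψ y) = y.1 ∧
        (∀ q : N.FibrePair, loopPair (ψ y) q = y.2.1 q) ∧
        ∀ k : N.FibrePoint, loopPoint (ψ y) k = y.2.2 k := by
  obtain ⟨E, hE, hmp⟩ := exists_measurePreserving_inverse (N.card_indepVar he p)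
    N.reduction (N.reduction_mem_iff he)
  let s1 := (MeasurableEquiv.sumPiEquivProdPi
    (fun _ : N.ReducedVar ⊕ (N.FibrePair ⊕ N.FibrePoint) => ℝ)).symm
  let s2 := (MeasurableEquiv.sumPiEquivProdPi (fun _ : N.FibrePair ⊕ N.FibrePoint => ℝ)).symm
  have m1 : MeasurePreserving s1 := volume_measurePreserving_sumPiEquivProdPi_symm _
  have m2 : MeasurePreserving s2 := volume_measurePreserving_sumPiEquivProdPi_symm _
  refine ⟨((MeasurableEquiv.prodCongr (MeasurableEquiv.refl _) s2).trans s1).trans E,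
    hmp.comp (m1.comp ((MeasurePreserving.id _).prod m2)), fun y => ?_⟩
  have h := hE (s1 (y.1, s2 y.2))
  refine ⟨funext fun j => ?_, fun q => ?_, fun k => ?_⟩
  · exact congrFun h (Sum.inl j)
  · exact congrFun h (Sum.inr (Sum.inl q))
  · exact congrFun h (Sum.inr (Sum.inr k))

section fibre

variable {e : Fin n × Fin n} {p : Fin n} {σ : IndepVar e p → ℝ} {δ : Fin n → Fin n → ℂ}

theorem reducedPoint_contourPoint (x : IndepVar e p → ℝ) (j : N.ReducedVar) :
    N.reducedPoint (N.contourPoint σ x) j =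
      N.reducedPoint (N.contourPoint σ 0) j - (2 * N.reducedPart x j : ℝ) * Complex.I := by
  rcases j with a | q
  · exact N.chainMandelstam_contourPoint σ x a
  · exact N.planar_contourPoint σ x q.1.1 q.1.2

/-- The point of the reduced contour with imaginary parts given by `w`. -/
noncomputable def reducedLine (σ : IndepVar e p → ℝ) (w : N.ReducedVar → ℝ) : N.ReducedVar → ℂ :=
  fun j => N.reducedPoint (N.contourPoint σ 0) j - (2 * w j : ℝ) * Complex.I

theorem reducedPoint_eq_reducedLine (x : IndepVar e p → ℝ) :
    N.reducedPoint (N.contourPoint σ x) = N.reducedLine σ (N.reducedPart x) :=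
  funext (N.reducedPoint_contourPoint x)

theorem re_inner_contourPoint (x : IndepVar e p → ℝ) (i j : Fin n) :
    ((N.contourPoint σ x).inner i j).re = ((N.contourPoint σ 0).inner i j).re := by
  rw [contourPoint_inner]
  conv_rhs => rw [contourPoint_zero_inner]
  unfold symMatrix
  split_ifs <;> simp

theorem left_eq (x : IndepVar e p → ℝ) (k : Fin n) : (N.contourPoint σ x).left k =
    -∑ j, (N.contourPoint σ x).inner k j - (N.contourPoint σ x).right k := by
  rw [contourPoint, ← N.solve_left_add_right]; ring

theorem IsLoopContour.right_pos (hσ : N.IsLoopContour δ e p σ) (x : IndepVar e p → ℝ) (k : Fin n) :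
    0 < ((N.contourPoint σ x).right k).re := by
  have h := hσ.2.1 k
  rw [← contourPoint_zero] at h
  rw [contourPoint_right]
  simpa using h

theorem IsLoopContour.left_pos (hσ : N.IsLoopContour δ e p σ) (x : IndepVar e p → ℝ) (k : Fin n) :
    ((N.contourPoint σ x).right k).re < (-∑ j, (N.contourPoint σ x).inner k j).re := by
  have h := hσ.1 k
  rw [← contourPoint_zero, left_eq] at h
  rw [contourPoint_right]
  simp only [Complex.sub_re, Complex.neg_re, Complex.re_sum, N.re_inner_contourPoint x] at h ⊢
  simpa using h

theorem IsLoopContour.inner_pos (hσ : N.IsLoopContour δ e p σ) (x : IndepVar e p → ℝ)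
    (q : PointPair n) : 0 < ((N.contourPoint σ x).inner q.1.1 q.1.2).re := by
  have h := (hσ.2.2 q.1.1 q.1.2 q.2).1
  rw [← contourPoint_zero] at h
  rwa [re_inner_contourPoint]

theorem IsLoopContour.inner_lt (hσ : N.IsLoopContour δ e p σ) (x : IndepVar e p → ℝ)
    (q : PointPair n) :
    ((N.contourPoint σ x).inner q.1.1 q.1.2).re < (δ q.1.1 q.1.2).re := by
  have h := (hσ.2.2 q.1.1 q.1.2 q.2).2
  rw [← contourPoint_zero] at h
  rw [re_inner_contourPoint]
  simpa using h

theorem loopIntegrand_contourPoint (M₀ : (Finset.Icc 2 r → ℂ) → ℂ) (x : IndepVar e p → ℝ) :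
    N.loopIntegrand M₀ δ e p (upwardLine σ x) =
      M₀ (fun a => N.reducedLine σ (N.reducedPart x) (Sum.inl a)) *
      ((∏ k, betaB ((N.contourPoint σ x).right k) (-∑ j, (N.contourPoint σ x).inner k j)) *
        ∏ q : PointPair n, betaB ((N.contourPoint σ x).inner q.1.1 q.1.2) (δ q.1.1 q.1.2)) := by
  rw [loopIntegrand, preKernel_eq, ← reducedPoint_eq_reducedLine]
  rfl

theorem integral_fibre (he : e.1 < e.2) (hδ : N.IsCanonical δ) (hσ : N.IsLoopContour δ e p σ)
    (M₀ : (Finset.Icc 2 r → ℂ) → ℂ)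
    (ψ : (N.ReducedVar → ℝ) × ((N.FibrePair → ℝ) × (N.FibrePoint → ℝ)) → (IndepVar e p → ℝ))
    (hψ : ∀ y, N.reducedPart (ψ y) = y.1 ∧ (∀ q : N.FibrePair, loopPair (ψ y) q = y.2.1 q) ∧
        ∀ k : N.FibrePoint, loopPoint (ψ y) k = y.2.2 k) (w : N.ReducedVar → ℝ)
    (hint : Integrable fun y => N.loopIntegrand M₀ δ e p (upwardLine σ (ψ (w, y)))) :
    ∫ y, N.loopIntegrand M₀ δ e p (upwardLine σ (ψ (w, y))) =
      (2 * Real.pi) ^ (Fintype.card N.FibrePair + Fintype.card N.FibrePoint) *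
        N.reducedIntegrand M₀ (N.planar δ) (N.reducedLine σ w) := by
  have hZ : ∀ u v, N.reducedLine σ w = N.reducedPoint (N.contourPoint σ (ψ (w, u, v))) :=
    fun u v => by rw [reducedPoint_eq_reducedLine, (hψ _).1]
  have hpair : ∀ u v, loopPair (ψ (w, u, v)) = loopPair (ψ (w, u, 0)) := fun u v => by
    have h0 : ∀ q, loopPair (ψ (w, u, v) - ψ (w, u, 0)) q ∈ (⊥ : AddSubgroup ℝ) := by
      refine N.pair_mem ⊥ (sum_loopPair he _) (fun q hq => ?_) fun q => ?_
      · change N.reducedPart (ψ (w, u, v) - ψ (w, u, 0)) (Sum.inr ⟨q, hq⟩) ∈ _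
        rw [map_sub, (hψ _).1, (hψ _).1, sub_self]
        exact zero_mem _
      · rw [map_sub, Pi.sub_apply, (hψ _).2.1, (hψ _).2.1, sub_self]
        exact zero_mem _
    ext q
    have := h0 q
    rw [AddSubgroup.mem_bot, map_sub, Pi.sub_apply, sub_eq_zero] at this
    exact this
  have hinner : ∀ u v, (N.contourPoint σ (ψ (w, u, v))).inner =
      (N.contourPoint σ (ψ (w, u, 0))).inner := fun u v => by
    rw [contourPoint_inner, hpair, ← contourPoint_inner]
  have hpoint : ∀ u, ∫ v, ∏ k, betaB ((N.contourPoint σ (ψ (w, u, v))).right k)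
      (-∑ j, (N.contourPoint σ (ψ (w, u, 0))).inner k j) =
      (2 * Real.pi) ^ Fintype.card N.FibrePoint *
        kernelTwo (r := r) (N.fullChain (N.reducedLine σ w)) (N.fullPlanar (N.reducedLine σ w)) := by
    intro u
    have h2 := N.kernelTwo_reducedPoint (upwardLine σ (ψ (w, u, 0))) he
    change kernelTwo (r := r) (N.fullChain (N.reducedPoint (N.contourPoint σ (ψ (w, u, 0)))))
        (N.fullPlanar (N.reducedPoint (N.contourPoint σ (ψ (w, u, 0))))) = _ at h2
    rw [← hZ] at h2
    rw [h2]
    refine integral_prod_betaB_fibre N.vertex N.vertexRep N.vertex_vertexRep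
      (fun k => (N.contourPoint σ 0).right k) _ _
      (fun v => (N.contourPoint σ (ψ (w, u, v))).right) (fun v k => ?_) (fun v a => ?_)
      (fun v k => hσ.right_pos N _ k) (fun v k => ?_)
    · rw [contourPoint_right, (hψ _).2.2]
    · have e1 := N.sum_right_vertex (upwardLine σ (ψ (w, u, v))) he a
      have e2 := N.sum_right_vertex (upwardLine σ (ψ (w, u, 0))) he a
      have hv := hZ u v
      have h0 := hZ u 0
      rw [contourPoint] at hv h0
      rw [← hv] at e1
      rw [← h0, ← e1] at e2
      exact e2.symm
    · rw [← hinner u v]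
      exact hσ.left_pos N _ k
  have hpairs : ∫ u, ∏ q : PointPair n, betaB ((N.contourPoint σ (ψ (w, u, 0))).inner q.1.1 q.1.2)
      (δ q.1.1 q.1.2) = (2 * Real.pi) ^ Fintype.card N.FibrePair *
        N.kernelOne (N.fullPlanar (N.reducedLine σ w)) (N.planar δ) := by
    have h2 := N.kernelOne_reducedPoint (upwardLine σ (ψ (w, 0, 0))) he hδ
    change N.kernelOne (N.fullPlanar (N.reducedPoint (N.contourPoint σ (ψ (w, 0, 0)))))
      (N.planar δ) = _ at h2
    rw [← hZ] at h2
    rw [h2]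
    refine integral_prod_betaB_fibre N.blockOf N.pairRep N.blockOf_pairRep
      (fun q => (N.contourPoint σ 0).inner q.1.1 q.1.2) (fun q => δ q.1.1 q.1.2) _
      (fun u q => (N.contourPoint σ (ψ (w, u, 0))).inner q.1.1 q.1.2) (fun u q => ?_)
      (fun u β => ?_) (fun u q => hσ.inner_pos N _ q) (fun u q => hσ.inner_lt N _ q)
    · rw [contourPoint_inner_apply, (hψ _).2.1]
    · have hβ : ∀ u, blockArg N.vertexDim
          (N.planar (N.contourPoint σ (ψ (w, u, 0))).inner) β =
          blockArg N.vertexDim (N.fullPlanar (N.reducedLine σ w)) β := fun u => by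
        have h : ∀ {a b}, 1 ≤ a → b ≤ r → _ := fun {a b} =>
          N.fullPlanar_reducedPoint (upwardLine σ (ψ (w, u, 0))) he (a := a) (b := b)
        obtain ⟨h1, h2, h3, -⟩ := N.mem_blocks.mp β.2
        rw [hZ u 0]
        unfold blockArg contourPoint
        rw [h h1 (h2.trans h3), h h1 (by omega), h (by omega) h3, h (by omega) (by omega),
          h h1 h3]
      exact (N.blockArg_solve (upwardLine σ (ψ (w, u, 0))) β).symm.trans
        ((hβ u).trans ((hβ 0).symm.trans (N.blockArg_solve (upwardLine σ (ψ (w, 0, 0))) β)))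
  rw [Measure.volume_eq_prod] at hint ⊢
  rw [integral_prod _ hint]
  have hstep : ∀ u, ∫ v, N.loopIntegrand M₀ δ e p (upwardLine σ (ψ (w, u, v))) =
      (M₀ (fun a => N.reducedLine σ w (Sum.inl a)) * ((2 * Real.pi) ^ Fintype.card N.FibrePoint *
        kernelTwo (r := r) (N.fullChain (N.reducedLine σ w))
          (N.fullPlanar (N.reducedLine σ w)))) *
      ∏ q : PointPair n, betaB ((N.contourPoint σ (ψ (w, u, 0))).inner q.1.1 q.1.2)
        (δ q.1.1 q.1.2) := fun u => by
    simp only [loopIntegrand_contourPoint, (hψ _).1, hinner, ← mul_assoc]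
    rw [integral_mul_const, integral_const_mul, hpoint]
    ring
  simp only [hstep]
  rw [integral_const_mul, hpairs, reducedIntegrand, pow_add]
  ring

theorem downwardLine_eq (x : N.ReducedVar → ℝ) :
    downwardLine (N.reducedContour e p σ) x = N.reducedLine σ
      ((1 / 2 : ℝ) • (x + fun j => (N.reducedPoint (N.contourPoint σ 0) j).im)) := by
  ext j
  have h : N.reducedContour e p σ j = (N.reducedPoint (N.contourPoint σ 0) j).re := by
    rw [contourPoint_zero]; rcases j with a | q <;> rfl
  rw [downwardLine, h, reducedLine]
  apply Complex.ext <;> simp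

theorem reduction_formula (he : e.1 < e.2) (hδ : N.IsCanonical δ) (hσ : N.IsLoopContour δ e p σ)
    (M₀ : (Finset.Icc 2 r → ℂ) → ℂ)
    (hint : Integrable fun x : IndepVar e p → ℝ => N.loopIntegrand M₀ δ e p (upwardLine σ x)) :
    Integrable (fun x : N.ReducedVar → ℝ =>
        N.reducedIntegrand M₀ (N.planar δ) (downwardLine (N.reducedContour e p σ) x)) ∧
      N.loopPreAmplitude M₀ δ e p σ =
        1 / (-2) ^ Fintype.card N.ReducedVar *
          mellinDown (N.reducedContour e p σ) (N.reducedIntegrand M₀ (N.planar δ)) := by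
  obtain ⟨ψ, hmp, hψ⟩ := N.exists_measurePreserving_reduction he p
  have hF : Integrable fun y => N.loopIntegrand M₀ δ e p (upwardLine σ (ψ y)) :=
    (hmp.integrable_comp_emb ψ.measurableEmbedding).mpr hint
  have hI : ∫ y, N.loopIntegrand M₀ δ e p (upwardLine σ (ψ y)) =
      ∫ x, N.loopIntegrand M₀ δ e p (upwardLine σ x) :=
    hmp.integral_comp' fun x => N.loopIntegrand M₀ δ e p (upwardLine σ x)
  rw [Measure.volume_eq_prod] at hF hI
  have hpi : (2 * Real.pi : ℂ) ≠ 0 := by simp [Real.pi_ne_zero]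
  set K : ℂ := (2 * Real.pi) ^ (Fintype.card N.FibrePair + Fintype.card N.FibrePoint) with hK
  have hK0 : K ≠ 0 := pow_ne_zero _ hpi
  set G : (N.ReducedVar → ℝ) → ℂ := fun w =>
    N.reducedIntegrand M₀ (N.planar δ) (N.reducedLine σ w) with hG
  have hae : (fun w => ∫ y, N.loopIntegrand M₀ δ e p (upwardLine σ (ψ (w, y)))) =ᵐ[volume]
      fun w => K * G w := by
    filter_upwards [hF.prod_right_ae] with w hw
    exact N.integral_fibre he hδ hσ M₀ ψ hψ w hw
  rw [integral_prod _ hF, integral_congr_ae hae, integral_const_mul] at hI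
  have hGi : Integrable G := by
    have h1 := (hF.integral_prod_left.congr hae).const_mul K⁻¹
    simpa only [← mul_assoc, inv_mul_cancel₀ hK0, one_mul] using h1
  simp only [mellinDown, N.downwardLine_eq]
  refine ⟨((hGi.comp_smul (R := (1 / 2 : ℝ)) (by norm_num)).comp_add_right _), ?_⟩
  have h2 := integral_add_right_eq_self (μ := volume)
    (fun x : N.ReducedVar → ℝ => G ((1 / 2 : ℝ) • x))
    (fun j => (N.reducedPoint (N.contourPoint σ 0) j).im)
  have h3 := Measure.integral_comp_smul (volume : Measure (N.ReducedVar → ℝ)) G (1 / 2 : ℝ)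
  rw [h3, Module.finrank_fintype_fun_eq_card, Complex.real_smul] at h2
  have hcard : Fintype.card (IndepVar e p) = Fintype.card N.ReducedVar +
      (Fintype.card N.FibrePair + Fintype.card N.FibrePoint) :=
    (N.card_indepVar he p).trans (by
      rw [Fintype.card_sum, Fintype.card_sum (α := N.FibrePair)])
  have h4 : |((1 / 2 : ℝ) ^ Fintype.card N.ReducedVar)⁻¹| = 2 ^ Fintype.card N.ReducedVar := by
    rw [abs_of_pos (by positivity), one_div, inv_pow, inv_inv]
  rw [h4] at h2
  rw [h2, loopPreAmplitude, mellinUp, ← hI, hcard, pow_add, hK,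
    one_div_pow (2 * (Real.pi : ℂ)) (Fintype.card N.FibrePair + _), ← mul_assoc,
    mul_assoc (_ ^ Fintype.card N.ReducedVar),
    one_div_mul_cancel (pow_ne_zero _ hpi), mul_one]
  push_cast
  rw [← mul_assoc, ← mul_assoc, ← one_div_pow, ← mul_pow, ← mul_pow]
  congr 2
  field_simp

end fibre

end NecklaceChain

/-! ### Decay of the kernel of loop formation -/

theorem one_add_abs_le_mul (a t : ℝ) : 1 + |t| ≤ (1 + |a|) * (1 + |a + t|) := by
  have h : |t| ≤ |a + t| + |a| := by
    have := abs_sub (a + t) a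
    rwa [add_sub_cancel_left] at this
  nlinarith [abs_nonneg a, abs_nonneg (a + t)]

/-- The product of the `1 + |t_i|`, a common bound for them. -/
def heightProd {ι : Type*} [Fintype ι] (t : ι → ℝ) : ℝ := ∏ i, (1 + |t i|)

theorem one_le_heightProd {ι : Type*} [Fintype ι] (t : ι → ℝ) : 1 ≤ heightProd t :=
  Finset.one_le_prod fun i _ => by simp

theorem one_add_abs_le_heightProd {ι : Type*} [Fintype ι] (t : ι → ℝ) (i : ι) :
    1 + |t i| ≤ heightProd t := by
  classical
  rw [heightProd, ← Finset.mul_prod_erase _ _ (Finset.mem_univ i)]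
  exact le_mul_of_one_le_right (by positivity) (Finset.one_le_prod fun i _ => by simp)

namespace NecklaceChain

variable {n r : ℕ} (N : NecklaceChain n r)

section decay

variable {e : Fin n × Fin n} {p : Fin n} {σ : IndepVar e p → ℝ} {δ : Fin n → Fin n → ℂ}

theorem one_add_norm_le_heightProd (x : IndepVar e p → ℝ) :
    1 + ‖x‖ ≤ heightProd (loopPair x) * heightProd (loopPoint x) := by
  have h1 := one_le_heightProd (loopPair x)
  have h2 := one_le_heightProd (loopPoint x)
  rw [← le_sub_iff_add_le', pi_norm_le_iff_of_nonneg (by nlinarith)]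
  rintro (q | k)
  · have := one_add_abs_le_heightProd (loopPair x) ⟨q.1, q.2.1⟩
    have e1 : loopPair x ⟨q.1, q.2.1⟩ = x (Sum.inl q) := dif_pos q.2.2
    rw [e1] at this
    rw [Real.norm_eq_abs]
    nlinarith
  · have := one_add_abs_le_heightProd (loopPoint x) k
    have e1 : loopPoint x k = x (Sum.inr k) := dif_pos k.2
    rw [e1] at this
    rw [Real.norm_eq_abs]
    nlinarith

theorem abs_im_inner_le (x : IndepVar e p → ℝ) (i j : Fin n) :
    |((N.contourPoint σ x).inner i j).im| ≤
      |((N.contourPoint σ 0).inner i j).im| + heightProd (loopPair x) := by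
  have h : ∀ q, |loopPair x q| ≤ heightProd (loopPair x) := fun q =>
    (le_add_of_nonneg_left zero_le_one).trans (one_add_abs_le_heightProd (loopPair x) q)
  have h1 := one_le_heightProd (loopPair x)
  rw [contourPoint_inner]
  conv_rhs => rw [contourPoint_zero_inner]
  unfold symMatrix
  split_ifs
  · simp only [Complex.add_im, Complex.im_ofReal_mul, Complex.I_im, mul_one]
    exact (abs_add_le _ _).trans (add_le_add_right (h _) _)
  · simp only [Complex.add_im, Complex.im_ofReal_mul, Complex.I_im, mul_one]
    exact (abs_add_le _ _).trans (add_le_add_right (h _) _)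
  · linarith

theorem exists_norm_betaB_inner_le (hσ : N.IsLoopContour δ e p σ) (m : ℕ) (q : PointPair n) :
    ∃ C, 0 < C ∧ ∀ x, ‖betaB ((N.contourPoint σ x).inner q.1.1 q.1.2) (δ q.1.1 q.1.2)‖ ≤
      C * ((1 + |loopPair x q|) ^ m)⁻¹ := by
  obtain ⟨C, hC, h⟩ := exists_norm_betaB_le m (hσ.inner_pos N 0 q) (hσ.inner_lt N 0 q)
  refine ⟨C * (1 + |(δ q.1.1 q.1.2).im|) ^ m *
    (1 + |((N.contourPoint σ 0).inner q.1.1 q.1.2).im|) ^ m, by positivity, fun x => ?_⟩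
  have h1 := h _ (δ q.1.1 q.1.2) (N.re_inner_contourPoint x q.1.1 q.1.2) rfl
  have h2 := one_add_abs_le_mul ((N.contourPoint σ 0).inner q.1.1 q.1.2).im (loopPair x q)
  have h3 : ((N.contourPoint σ x).inner q.1.1 q.1.2).im =
      ((N.contourPoint σ 0).inner q.1.1 q.1.2).im + loopPair x q := by
    rw [contourPoint_inner_apply]; simp
  rw [h3] at h1
  refine h1.trans ?_
  rw [mul_assoc C, mul_assoc C, mul_assoc]
  gcongr
  rw [← div_eq_mul_inv, le_div_iff₀ (by positivity), ← inv_pow, ← mul_pow]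
  refine pow_le_pow_left₀ (by positivity) ?_ m
  rw [inv_mul_le_iff₀ (by positivity)]
  linarith

theorem exists_norm_betaB_right_le (hσ : N.IsLoopContour δ e p σ) (m : ℕ) (k : Fin n) :
    ∃ C, 0 < C ∧ ∀ x, ‖betaB ((N.contourPoint σ x).right k)
      (-∑ j, (N.contourPoint σ x).inner k j)‖ ≤
      C * (heightProd (loopPair x) ^ m * ((1 + |loopPoint x k|) ^ m)⁻¹) := by
  obtain ⟨C, hC, h⟩ := exists_norm_betaB_le m (hσ.right_pos N 0 k) (hσ.left_pos N 0 k)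
  set B : ℝ := 1 + ∑ j : Fin n, (|((N.contourPoint σ 0).inner k j).im| + 1) with hB
  have hB0 : 0 < B := by positivity
  refine ⟨C * B ^ m * (1 + |((N.contourPoint σ 0).right k).im|) ^ m, by positivity, fun x => ?_⟩
  have h1 := h ((N.contourPoint σ x).right k) (-∑ j, (N.contourPoint σ x).inner k j)
    (by rw [contourPoint_right]; simp)
    (by simp only [Complex.neg_re, Complex.re_sum, N.re_inner_contourPoint x])
  have h2 := one_add_abs_le_mul ((N.contourPoint σ 0).right k).im (loopPoint x k)
  have h3 : ((N.contourPoint σ x).right k).im =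
      ((N.contourPoint σ 0).right k).im + loopPoint x k := by
    rw [contourPoint_right]; simp
  have h4 := one_le_heightProd (loopPair x)
  have h5 : 1 + |(-∑ j, (N.contourPoint σ x).inner k j).im| ≤ B * heightProd (loopPair x) := by
    rw [Complex.neg_im, abs_neg, Complex.im_sum, hB, add_mul, Finset.sum_mul, one_mul]
    refine add_le_add h4 ((Finset.abs_sum_le_sum_abs _ _).trans (Finset.sum_le_sum fun j _ => ?_))
    have := N.abs_im_inner_le (σ := σ) x k j
    nlinarith [abs_nonneg ((N.contourPoint σ 0).inner k j).im]
  rw [h3] at h1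
  refine h1.trans ?_
  calc _ ≤ C * ((B * heightProd (loopPair x)) ^ m * ((1 + |((N.contourPoint σ 0).right k).im|) ^ m *
        ((1 + |loopPoint x k|) ^ m)⁻¹)) := by
        gcongr
        rw [← div_eq_mul_inv, le_div_iff₀ (by positivity), ← inv_pow, ← mul_pow]
        refine pow_le_pow_left₀ (by positivity) ?_ m
        rw [inv_mul_le_iff₀ (by positivity)]
        linarith
    _ = _ := by rw [mul_pow]; ring

/-- The kernel of loop formation decays on the contour faster than any power. -/
theorem exists_norm_kernel_le (hσ : N.IsLoopContour δ e p σ) (m : ℕ) :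
    ∃ C, 0 < C ∧ ∀ x,
      ‖(∏ k, betaB ((N.contourPoint σ x).right k) (-∑ j, (N.contourPoint σ x).inner k j)) *
        ∏ q : PointPair n, betaB ((N.contourPoint σ x).inner q.1.1 q.1.2) (δ q.1.1 q.1.2)‖ ≤
      C * ((1 + ‖x‖) ^ m)⁻¹ := by
  choose C hC h using N.exists_norm_betaB_right_le hσ m
  choose C' hC' h' using N.exists_norm_betaB_inner_le hσ (m * n + m)
  refine ⟨(∏ k, C k) * ∏ q, C' q, mul_pos (Finset.prod_pos fun k _ => hC k)
    (Finset.prod_pos fun q _ => hC' q), fun x => ?_⟩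
  have h1 := one_le_heightProd (loopPair x)
  have h2 := one_le_heightProd (loopPoint x)
  have e1 : ∏ k, ‖betaB ((N.contourPoint σ x).right k) (-∑ j, (N.contourPoint σ x).inner k j)‖ ≤
      (∏ k, C k) * (heightProd (loopPair x) ^ (m * n) * (heightProd (loopPoint x) ^ m)⁻¹) := by
    refine (Finset.prod_le_prod (fun _ _ => norm_nonneg _) fun k _ => h k x).trans (le_of_eq ?_)
    rw [Finset.prod_mul_distrib, Finset.prod_mul_distrib, Finset.prod_const, Finset.card_univ,
      Fintype.card_fin, ← pow_mul, Finset.prod_inv_distrib, Finset.prod_pow]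
    rfl
  have e2 : ∏ q : PointPair n,
      ‖betaB ((N.contourPoint σ x).inner q.1.1 q.1.2) (δ q.1.1 q.1.2)‖ ≤
      (∏ q, C' q) * (heightProd (loopPair x) ^ (m * n + m))⁻¹ := by
    refine (Finset.prod_le_prod (fun _ _ => norm_nonneg _) fun k _ => h' k x).trans (le_of_eq ?_)
    rw [Finset.prod_mul_distrib, Finset.prod_inv_distrib, Finset.prod_pow]
    rfl
  rw [norm_mul, norm_prod, norm_prod]
  have h3 := Finset.prod_pos fun k (_ : k ∈ Finset.univ) => hC k
  have h4 := Finset.prod_pos fun k (_ : k ∈ Finset.univ) => hC' k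
  calc _ ≤ ((∏ k, C k) * (heightProd (loopPair x) ^ (m * n) * (heightProd (loopPoint x) ^ m)⁻¹)) *
        ((∏ q, C' q) * (heightProd (loopPair x) ^ (m * n + m))⁻¹) :=
        mul_le_mul e1 e2 (Finset.prod_nonneg fun _ _ => norm_nonneg _) (by positivity)
    _ = ((∏ k, C k) * ∏ q, C' q) *
        ((heightProd (loopPair x) * heightProd (loopPoint x)) ^ m)⁻¹ := by
        rw [pow_add, mul_pow]
        have : heightProd (loopPair x) ≠ 0 := by positivity
        field_simp
    _ ≤ _ := by
        gcongr
        exact one_add_norm_le_heightProd x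

end decay

end NecklaceChain

/-! ### Growth of the chain pre-amplitude -/

/-- A function of at most polynomial growth. -/
def PolyBounded {E : Type*} [NormedAddCommGroup E] (f : E → ℂ) : Prop :=
  ∃ C, ∃ m : ℕ, 0 < C ∧ ∀ x, ‖f x‖ ≤ C * (1 + ‖x‖) ^ m

namespace PolyBounded

variable {E : Type*} [NormedAddCommGroup E]

theorem congr {f g : E → ℂ} (hf : PolyBounded f) (h : ∀ x, f x = g x) : PolyBounded g :=
  (funext h : f = g) ▸ hf

theorem const (c : ℂ) : PolyBounded fun _ : E => c :=
  ⟨‖c‖ + 1, 0, by positivity, fun x => by simp⟩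

theorem mul {f g : E → ℂ} (hf : PolyBounded f) (hg : PolyBounded g) :
    PolyBounded fun x => f x * g x := by
  obtain ⟨C, m, hC, h⟩ := hf
  obtain ⟨C', m', hC', h'⟩ := hg
  refine ⟨C * C', m + m', by positivity, fun x => ?_⟩
  rw [norm_mul]
  calc _ ≤ (C * (1 + ‖x‖) ^ m) * (C' * (1 + ‖x‖) ^ m') :=
        mul_le_mul (h x) (h' x) (norm_nonneg _) (by positivity)
    _ = _ := by rw [pow_add]; ring

theorem prod {ι : Type*} (s : Finset ι) {f : ι → E → ℂ} (hf : ∀ i ∈ s, PolyBounded (f i)) :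
    PolyBounded fun x => ∏ i ∈ s, f i x := by
  classical
  induction s using Finset.induction_on with
  | empty => simpa using const 1
  | insert a s ha ih =>
    simp only [Finset.prod_insert ha]
    exact (hf a (Finset.mem_insert_self a s)).mul
      (ih fun i hi => hf i (Finset.mem_insert_of_mem hi))

theorem of_norm_le {f : E → ℂ} (C : ℝ) (h : ∀ x, ‖f x‖ ≤ C) : PolyBounded f :=
  ⟨|C| + 1, 0, by positivity, fun x => by
    have := h x; have := le_abs_self C; simp only [pow_zero, mul_one]; linarith⟩

theorem gamma_div_gamma {α : ℂ} (hα : 0 < α.re) (β : ℂ) {l : E → ℝ} {A : ℝ}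
    (hl : ∀ x, |l x| ≤ A * ‖x‖) :
    PolyBounded fun x => Complex.Gamma (α + l x * Complex.I) /
      Complex.Gamma (β + l x * Complex.I) := by
  obtain ⟨C, m, hC, h⟩ := exists_norm_Gamma_div_Gamma_le hα β
  refine ⟨C * (1 + |A|) ^ m, m, by positivity, fun x => (h (l x)).trans ?_⟩
  rw [mul_assoc, ← mul_pow]
  gcongr
  have := hl x
  nlinarith [norm_nonneg x, abs_nonneg A, le_abs_self A,
    mul_le_mul_of_nonneg_right (le_abs_self A) (norm_nonneg x)]

end PolyBounded

theorem integrable_Gamma_sub {z : ℂ} (hz : 0 < z.re) :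
    Integrable fun u : ℝ => Complex.Gamma (z - u * Complex.I) := by
  obtain ⟨C, hC, hb⟩ := exists_norm_Gamma_le 2 hz
  have hi : Integrable fun u : ℝ => C * (1 + (z.im - u) ^ 2)⁻¹ :=
    (integrable_inv_one_add_sq.comp_sub_left z.im).const_mul C
  refine hi.mono' (measurable_Gamma.comp (by fun_prop)).aestronglyMeasurable
    (Filter.Eventually.of_forall fun u => ?_)
  refine (hb (z - u * Complex.I) (by simp)).trans ?_
  have h : (z - u * Complex.I).im = z.im - u := by simp
  rw [h]
  have : 1 + (z.im - u) ^ 2 ≤ (1 + |z.im - u|) ^ 2 := by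
    nlinarith [abs_nonneg (z.im - u), sq_abs (z.im - u)]
  gcongr

namespace NecklaceChain

theorem exists_norm_correctionLeg_le (h c : ℂ) {S ω : ℝ} (hS : 0 < (h - c).re - S)
    (hω : ω < 0) (hωS : 0 < ((h + c).re - S) / 2 + ω) :
    ∃ C, 0 < C ∧ ∀ s w : ℂ, s.re = S → w.re = ω →
      ‖correctionLeg h c s w * Complex.Gamma ((h - c - s) / 2)‖ ≤
        C * ‖Complex.Gamma (-c - w)‖ := by
  obtain ⟨C, hC, hb⟩ := exists_norm_beta_le 0 hωS (neg_pos.mpr hω)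
  refine ⟨C, hC, fun s w hs hw => ?_⟩
  have h1 := hb ((h + c - s) / 2 + w) (-w) (by simp [hs, hw]) (by simp [hw])
  simp only [pow_zero, inv_one, mul_one, add_neg_cancel_right] at h1
  have h2 : Complex.Gamma ((h - c - s) / 2) ≠ 0 := Complex.Gamma_ne_zero_of_re_pos (by
    simp only [Complex.sub_re, Complex.div_ofNat_re] at hS ⊢
    rw [hs]; linarith)
  have h3 : correctionLeg h c s w * Complex.Gamma ((h - c - s) / 2) =
      (Complex.Gamma ((h + c - s) / 2 + w) * Complex.Gamma (-w) /
        Complex.Gamma ((h + c - s) / 2)) * Complex.Gamma (-c - w) := by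
    rw [correctionLeg, propagatorFactor]
    field_simp
  rw [h3, norm_mul]
  gcongr

theorem exists_norm_vertexCorrection_le (h D c c' : ℂ) {S S' : ℝ} {ω : Fin 2 → ℝ}
    (hS : 0 < (h - c).re - S) (hS' : 0 < (h - c').re - S')
    (h0 : ω 0 < 0) (h0c : ω 0 < -c.re) (h0S : 0 < ((h + c).re - S) / 2 + ω 0)
    (h1 : ω 1 < 0) (h1c : ω 1 < -c'.re) (h1S : 0 < ((h + c').re - S') / 2 + ω 1)
    (hD : 0 < (D + c + c').re / 2 + ω 0 + ω 1) :
    ∃ C, ∀ s s' : ℂ, s.re = S → s'.re = S' →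
      ‖vertexCorrection h D c c' s s' ω * (Complex.Gamma ((h - c - s) / 2) *
        Complex.Gamma ((h - c' - s') / 2))‖ ≤ C := by
  obtain ⟨C, hC, hb⟩ := exists_norm_correctionLeg_le h c hS h0 h0S
  obtain ⟨C', hC', hb'⟩ := exists_norm_correctionLeg_le h c' hS' h1 h1S
  obtain ⟨G, hG, hbG⟩ := exists_norm_Gamma_le 0 hD
  set cs : Fin 2 → ℂ := ![c, c'] with hcs
  set bound : (Fin 2 → ℝ) → ℝ := fun x => (G / ‖gammaPM D c c'‖) * (C * C' *
    ‖∏ b, Complex.Gamma ((-cs b - ω b) - x b * Complex.I)‖) with hbound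
  have hi : Integrable bound := by
    have := Integrable.fintype_prod (ι := Fin 2)
      (f := fun b (y : ℝ) => Complex.Gamma ((-cs b - ω b) - y * Complex.I)) (fun b => by
        refine integrable_Gamma_sub ?_
        fin_cases b
        · simpa [hcs] using h0c
        · simpa [hcs] using h1c)
    exact (this.norm.const_mul _).const_mul _
  refine ⟨‖(1 / (2 * (Real.pi : ℂ))) ^ Fintype.card (Fin 2)‖ * ∫ x, bound x,
    fun s s' hs hs' => ?_⟩
  rw [vertexCorrection, mellinUp, mul_assoc, norm_mul, ← integral_mul_const]
  gcongr
  refine norm_integral_le_of_norm_le hi (Filter.Eventually.of_forall fun x => ?_)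
  have e0 : ∀ b, (upwardLine ω x b).re = ω b := fun b => by simp [upwardLine]
  have l0 := hb s (upwardLine ω x 0) hs (e0 0)
  have l1 := hb' s' (upwardLine ω x 1) hs' (e0 1)
  have l2 := hbG ((D + c + c') / 2 + upwardLine ω x 0 + upwardLine ω x 1) (by
    simp only [Complex.add_re, e0, Complex.div_ofNat_re])
  simp only [pow_zero, inv_one, mul_one] at l2
  have e1 : ∏ b, Complex.Gamma ((-cs b - ω b) - x b * Complex.I) =
      Complex.Gamma (-c - upwardLine ω x 0) * Complex.Gamma (-c' - upwardLine ω x 1) := by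
    rw [Fin.prod_univ_two]
    simp only [hcs, upwardLine, Matrix.cons_val_zero, Matrix.cons_val_one, sub_sub]
  have e2 : Complex.Gamma ((D + c + c') / 2 + upwardLine ω x 0 + upwardLine ω x 1) /
      gammaPM D c c' * (correctionLeg h c s (upwardLine ω x 0) *
        correctionLeg h c' s' (upwardLine ω x 1)) *
      (Complex.Gamma ((h - c - s) / 2) * Complex.Gamma ((h - c' - s') / 2)) =
      Complex.Gamma ((D + c + c') / 2 + upwardLine ω x 0 + upwardLine ω x 1) / gammaPM D c c' *
      ((correctionLeg h c s (upwardLine ω x 0) * Complex.Gamma ((h - c - s) / 2)) *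
      (correctionLeg h c' s' (upwardLine ω x 1) * Complex.Gamma ((h - c' - s') / 2))) := by ring
  rw [e2, norm_mul, norm_div, norm_mul]
  calc _ ≤ G / ‖gammaPM D c c'‖ * ((C * ‖Complex.Gamma (-c - upwardLine ω x 0)‖) *
        (C' * ‖Complex.Gamma (-c' - upwardLine ω x 1)‖)) := by gcongr
    _ = bound x := by rw [hbound]; simp only [e1, norm_mul]; ring

theorem measurable_vertexCorrection (h D c c' : ℂ) (ω : Fin 2 → ℝ) {α : Type*} [MeasurableSpace α]
    {f g : α → ℂ} (hf : Measurable f) (hg : Measurable g) :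
    Measurable fun x => vertexCorrection h D c c' (f x) (g x) ω := by
  unfold vertexCorrection mellinUp
  refine measurable_const.mul (StronglyMeasurable.measurable ?_)
  refine StronglyMeasurable.integral_prod_right (f := fun (x : α) (y : Fin 2 → ℝ) =>
    Complex.Gamma ((D + c + c') / 2 + upwardLine ω y 0 + upwardLine ω y 1) / gammaPM D c c' *
    (correctionLeg h c (f x) (upwardLine ω y 0) * correctionLeg h c' (g x) (upwardLine ω y 1)))
    (Measurable.stronglyMeasurable ?_)
  have hu : ∀ b, Measurable fun y : α × (Fin 2 → ℝ) => upwardLine ω y.2 b := fun b => by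
    unfold upwardLine; fun_prop
  have hG := fun {k : α × (Fin 2 → ℝ) → ℂ} (hk : Measurable k) => measurable_Gamma.comp hk
  have hleg : ∀ (c : ℂ) {k w : α × (Fin 2 → ℝ) → ℂ}, Measurable k → Measurable w →
      Measurable fun y => correctionLeg h c (k y) (w y) := fun c k w hk hw => by
    unfold correctionLeg propagatorFactor
    exact (((hG hw.neg).mul (hG (hw.const_sub _))).mul (hG (by fun_prop))).div
      ((hG (by fun_prop)).mul (hG (by fun_prop)))
  exact ((hG (((hu 0).const_add _).add (hu 1))).div_const _).mul
    ((hleg c (hf.comp measurable_fst) (hu 0)).mul (hleg c' (hg.comp measurable_fst) (hu 1)))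

end NecklaceChain

/-! ### Integrability for the chain pre-amplitude -/

theorem prod_Icc_mul_shift {r : ℕ} (f : ℕ → ℂ) (hf : ∀ a, a ∉ Finset.Icc 2 r → f a = 1) :
    ∏ a ∈ Finset.Icc 1 r, (f a * f (a + 1)) = ∏ a ∈ Finset.Icc 2 r, f a ^ 2 := by
  have h1 : ∏ a ∈ Finset.Icc 1 r, f a = ∏ a ∈ Finset.Icc 2 r, f a :=
    (Finset.prod_subset (Finset.Icc_subset_Icc_left (by norm_num)) fun a _ ha => hf a ha).symm
  have h2 : ∏ a ∈ Finset.Icc 1 r, f (a + 1) = ∏ a ∈ Finset.Icc 2 r, f a := by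
    have h3 : ∏ a ∈ Finset.Icc (1 + 1) (r + 1), f a = ∏ a ∈ Finset.Icc 1 r, f (a + 1) := by
      rw [← Finset.image_add_right_Icc, Finset.prod_image (by intro a _ b _ h; simpa using h)]
    rw [← h3]
    exact (Finset.prod_subset (Finset.Icc_subset_Icc_right (by omega)) fun a _ ha => hf a ha).symm
  rw [Finset.prod_mul_distrib, h1, h2, Finset.prod_pow, sq]

namespace NecklaceChain

variable {n r : ℕ} (N : NecklaceChain n r)

section chain

variable {e : Fin n × Fin n} {p : Fin n} {σ : IndepVar e p → ℝ} {δ : Fin n → Fin n → ℂ}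

/-- The chain Mandelstam variables on the contour, extended by zero. -/
noncomputable def chainLine (σ : IndepVar e p → ℝ) (x : IndepVar e p → ℝ) (a : ℕ) : ℂ :=
  if ha : a ∈ Finset.Icc 2 r then N.reducedLine σ (N.reducedPart x) (Sum.inl ⟨a, ha⟩) else 0

theorem exists_chainLine_eq {a : ℕ} (ha : a ∈ Finset.Icc 2 r) :
    ∃ l : (IndepVar e p → ℝ) → ℝ, ∃ A : ℝ, (∀ x, |l x| ≤ A * ‖x‖) ∧ ∀ x β,
      (β - N.chainLine σ x a) / 2 =
        (β - N.chainMandelstam (N.contourPoint σ 0) a) / 2 + l x * Complex.I := by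
  refine ⟨fun x => N.reducedPart x (Sum.inl ⟨a, ha⟩), ‖LinearMap.toContinuousLinearMap
    (N.reducedPart (e := e) (p := p))‖, fun x => ?_, fun x β => ?_⟩
  · have h1 := (LinearMap.toContinuousLinearMap (N.reducedPart (e := e) (p := p))).le_opNorm x
    have h2 := norm_le_pi_norm (N.reducedPart x) (Sum.inl ⟨a, ha⟩)
    exact h2.trans h1
  · rw [chainLine, dif_pos ha, reducedLine, reducedPoint]
    simp only [Sum.elim_inl]
    push_cast
    ring

theorem measurable_chainLine (a : ℕ) : Measurable fun x => N.chainLine σ x a := by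
  unfold chainLine
  split_ifs with ha
  · have h : Measurable (N.reducedPart (e := e) (p := p)) :=
      (LinearMap.continuous_of_finiteDimensional _).measurable
    have h2 : Measurable fun x => N.reducedPart (e := e) (p := p) x (Sum.inl ⟨a, ha⟩) :=
      (measurable_pi_apply _).comp h
    unfold reducedLine
    fun_prop
  · exact measurable_const

theorem re_chainLine {a : ℕ} (ha : a ∈ Finset.Icc 2 r) (x : IndepVar e p → ℝ) :
    (N.chainLine σ x a).re = (N.chainMandelstam (N.contourPoint σ 0) a).re := by
  rw [chainLine, dif_pos ha, reducedLine, reducedPoint]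
  simp

/-- A Gamma function of each chain variable, whose growth is compared with that of the factors of
the chain pre-amplitude. -/
noncomputable def pivot (γ : ℕ → ℂ) (σ : IndepVar e p → ℝ) (a : ℕ) (x : IndepVar e p → ℝ) : ℂ :=
  if a ∈ Finset.Icc 2 r then Complex.Gamma ((N.h + γ a - N.chainLine σ x a) / 2) else 1

theorem pivot_of_mem (γ : ℕ → ℂ) {a : ℕ} (ha : a ∈ Finset.Icc 2 r) (x : IndepVar e p → ℝ) :
    N.pivot γ σ a x = Complex.Gamma ((N.h + γ a - N.chainLine σ x a) / 2) := if_pos ha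

theorem pivot_of_notMem (γ : ℕ → ℂ) {a : ℕ} (ha : a ∉ Finset.Icc 2 r) (x : IndepVar e p → ℝ) :
    N.pivot γ σ a x = 1 := if_neg ha

variable {γ : ℕ → ℂ} {ω : ℕ → Fin 2 → ℝ}

theorem polyBounded_pivot_div {a : ℕ} (ha : a ∈ Finset.Icc 2 r)
    (hpos : 0 < (N.h + γ a).re - (N.chainMandelstam (N.contourPoint σ 0) a).re) (β : ℂ) :
    PolyBounded fun x => N.pivot γ σ a x / Complex.Gamma ((β - N.chainLine σ x a) / 2) := by
  obtain ⟨l, A, hl, hX⟩ := N.exists_chainLine_eq (σ := σ) ha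
  simp only [N.pivot_of_mem γ ha, hX]
  refine PolyBounded.gamma_div_gamma ?_ _ hl
  rw [Complex.div_ofNat_re, Complex.sub_re]
  linarith

theorem polyBounded_propagatorFactor {a : ℕ} (ha : a ∈ Finset.Icc 2 r)
    (hpos : 0 < (N.h + γ a).re - (N.chainMandelstam (N.contourPoint σ 0) a).re)
    (hneg : 0 < (N.h - γ a).re - (N.chainMandelstam (N.contourPoint σ 0) a).re) :
    PolyBounded fun x =>
      propagatorFactor N.h (γ a) (N.chainLine σ x a) / N.pivot γ σ a x ^ 2 := by
  obtain ⟨l, A, hl, hX⟩ := N.exists_chainLine_eq (σ := σ) ha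
  have h1 : PolyBounded fun x => Complex.Gamma ((N.h - γ a - N.chainLine σ x a) / 2) /
      N.pivot γ σ a x := by
    simp only [N.pivot_of_mem γ ha, hX]
    refine PolyBounded.gamma_div_gamma ?_ _ hl
    rw [Complex.div_ofNat_re, Complex.sub_re]
    linarith
  have h2 : ∀ x, propagatorFactor N.h (γ a) (N.chainLine σ x a) / N.pivot γ σ a x ^ 2 =
      Complex.Gamma ((N.h - γ a - N.chainLine σ x a) / 2) / N.pivot γ σ a x := fun x => by
    have h0 : Complex.Gamma ((N.h + γ a - N.chainLine σ x a) / 2) ≠ 0 :=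
      Complex.Gamma_ne_zero_of_re_pos (by
        rw [Complex.div_ofNat_re, Complex.sub_re, N.re_chainLine ha]
        linarith)
    rw [propagatorFactor, N.pivot_of_mem γ ha]
    field_simp
  simpa only [h2] using h1

theorem polyBounded_endVertex {a : ℕ} (ha : a ∈ Finset.Icc 2 r)
    (hpos : 0 < (N.h + γ a).re - (N.chainMandelstam (N.contourPoint σ 0) a).re) (h D c : ℂ) :
    PolyBounded fun x => endVertex h D c (N.chainLine σ x a) * N.pivot γ σ a x := by
  refine ((PolyBounded.const (Complex.Gamma ((D - h + c) / 2) *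
    Complex.Gamma ((D - h - c) / 2))).mul (N.polyBounded_pivot_div ha hpos D)).congr fun x => ?_
  rw [endVertex]
  ring

theorem polyBounded_vertexFactor
    (hc : N.IsChainContour γ ω fun a => (N.chainMandelstam (N.contourPoint σ 0) a).re) {a : ℕ}
    (ha : a ∈ Finset.Icc 1 r) :
    PolyBounded fun x => N.vertexFactor γ ω (N.chainLine σ x) a *
      (N.pivot γ σ a x * N.pivot γ σ (a + 1) x) := by
  rw [Finset.mem_Icc] at ha
  unfold vertexFactor
  split_ifs with h1 h2 h3
  · have e1 : a ∉ Finset.Icc 2 r := by rw [Finset.mem_Icc]; omega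
    have e2 : a + 1 ∉ Finset.Icc 2 r := by rw [Finset.mem_Icc]; omega
    simp only [N.pivot_of_notMem γ e1, N.pivot_of_notMem γ e2]
    exact PolyBounded.const _
  · subst h2
    have e1 : 1 ∉ Finset.Icc 2 r := by rw [Finset.mem_Icc]; omega
    have e2 : 2 ∈ Finset.Icc 2 r := by rw [Finset.mem_Icc]; omega
    simp only [N.pivot_of_notMem γ e1, one_mul]
    exact N.polyBounded_endVertex e2 (hc.1 2 e2).1 _ _ _
  · subst h3
    have e1 : a ∈ Finset.Icc 2 a := by rw [Finset.mem_Icc]; omega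
    have e2 : a + 1 ∉ Finset.Icc 2 a := by rw [Finset.mem_Icc]; omega
    simp only [N.pivot_of_notMem γ e2, mul_one]
    exact N.polyBounded_endVertex e1 (hc.1 a e1).1 _ _ _
  · have e1 : a ∈ Finset.Icc 2 r := by rw [Finset.mem_Icc]; omega
    have e2 : a + 1 ∈ Finset.Icc 2 r := by rw [Finset.mem_Icc]; omega
    obtain ⟨p1, q1⟩ := hc.1 a e1
    obtain ⟨p2, q2⟩ := hc.1 (a + 1) e2
    obtain ⟨w1, w2, w3, w4, w5, w6, w7⟩ := hc.2 a (by rw [Finset.mem_Ioo]; omega)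
    obtain ⟨C, hC⟩ := exists_norm_vertexCorrection_le N.h (N.vertexDim a) (γ a) (γ (a + 1))
      q1 q2 w1 w2 w3 w4 w5 w6 w7
    have hV : PolyBounded fun x : IndepVar e p → ℝ =>
        vertexCorrection N.h (N.vertexDim a) (γ a) (γ (a + 1)) (N.chainLine σ x a)
          (N.chainLine σ x (a + 1)) (ω a) *
        (Complex.Gamma ((N.h - γ a - N.chainLine σ x a) / 2) *
          Complex.Gamma ((N.h - γ (a + 1) - N.chainLine σ x (a + 1)) / 2)) :=
      PolyBounded.of_norm_le C fun x => hC _ _ (N.re_chainLine e1 x) (N.re_chainLine e2 x)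
    refine (((PolyBounded.const (gammaPM (N.vertexDim a) (γ a) (γ (a + 1)))).mul hV).mul
      ((N.polyBounded_pivot_div e1 p1 (N.h - γ a)).mul
        (N.polyBounded_pivot_div e2 p2 (N.h - γ (a + 1))))).congr fun x => ?_
    have g1 : Complex.Gamma ((N.h - γ a - N.chainLine σ x a) / 2) ≠ 0 :=
      Complex.Gamma_ne_zero_of_re_pos (by
        rw [Complex.div_ofNat_re, Complex.sub_re, N.re_chainLine e1]
        linarith)
    have g2 : Complex.Gamma ((N.h - γ (a + 1) - N.chainLine σ x (a + 1)) / 2) ≠ 0 :=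
      Complex.Gamma_ne_zero_of_re_pos (by
        rw [Complex.div_ofNat_re, Complex.sub_re, N.re_chainLine e2]
        linarith)
    field_simp

theorem polyBounded_chainPreAmplitude
    (hc : N.IsChainContour γ ω fun a => (N.chainMandelstam (N.contourPoint σ 0) a).re) :
    PolyBounded fun x : IndepVar e p → ℝ => N.chainPreAmplitude γ ω
      fun a => N.reducedLine σ (N.reducedPart x) (Sum.inl a) := by
  refine ((PolyBounded.prod (Finset.Icc 2 r) fun a ha => N.polyBounded_propagatorFactor (σ := σ) ha
    (hc.1 a ha).1 (hc.1 a ha).2).mul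
    (PolyBounded.prod (Finset.Icc 1 r) fun a ha => N.polyBounded_vertexFactor hc ha)).congr
      fun x => ?_
  have h := prod_Icc_mul_shift (r := r) (fun a => N.pivot γ σ a x)
    fun a ha => N.pivot_of_notMem γ ha x
  have h0 : ∏ a ∈ Finset.Icc 2 r, N.pivot γ σ a x ^ 2 ≠ 0 := by
    refine Finset.prod_ne_zero_iff.mpr fun a ha => pow_ne_zero _ ?_
    rw [N.pivot_of_mem γ ha]
    refine Complex.Gamma_ne_zero_of_re_pos ?_
    rw [Complex.div_ofNat_re, Complex.sub_re, N.re_chainLine ha]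
    linarith [(hc.1 a ha).1]
  rw [Finset.prod_div_distrib, Finset.prod_mul_distrib (f := fun a =>
    N.vertexFactor γ ω (N.chainLine σ x) a), h, div_mul_eq_mul_div, ← mul_assoc,
    mul_div_cancel_right₀ _ h0]
  rfl

theorem measurable_chainPreAmplitude (γ : ℕ → ℂ) (ω : ℕ → Fin 2 → ℝ) :
    Measurable fun x : IndepVar e p → ℝ => N.chainPreAmplitude γ ω
      fun a => N.reducedLine σ (N.reducedPart x) (Sum.inl a) := by
  have hX := fun a => N.measurable_chainLine (σ := σ) a
  have hG : ∀ β a, Measurable fun x => Complex.Gamma ((β - N.chainLine σ x a) / 2) := fun β a =>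
    measurable_Gamma.comp (((hX a).const_sub β).div_const 2)
  change Measurable fun x => (∏ a ∈ Finset.Icc 2 r, propagatorFactor N.h (γ a) (N.chainLine σ x a)) *
    ∏ a ∈ Finset.Icc 1 r, N.vertexFactor γ ω (N.chainLine σ x) a
  refine (Finset.measurable_prod _ fun a _ => (hG _ a).mul (hG _ a)).mul
    (Finset.measurable_prod _ fun a _ => ?_)
  unfold vertexFactor
  split_ifs
  · exact measurable_const
  · exact measurable_const.div (hG _ 2)
  · exact measurable_const.div (hG _ r)
  · exact (measurable_vertexCorrection _ _ _ _ _ (hX a) (hX (a + 1))).const_mul _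

theorem measurable_kernel (σ : IndepVar e p → ℝ) (δ : Fin n → Fin n → ℂ) : Measurable fun x =>
    (∏ k, betaB ((N.contourPoint σ x).right k) (-∑ j, (N.contourPoint σ x).inner k j)) *
      ∏ q : PointPair n, betaB ((N.contourPoint σ x).inner q.1.1 q.1.2) (δ q.1.1 q.1.2) := by
  have hP : Measurable (loopPair (e := e) (p := p)) :=
    (LinearMap.continuous_of_finiteDimensional _).measurable
  have hK : Measurable (loopPoint (e := e) (p := p)) :=
    (LinearMap.continuous_of_finiteDimensional _).measurable
  have hP' : ∀ q, Measurable fun x => loopPair (e := e) (p := p) x q := fun q =>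
    (measurable_pi_apply q).comp hP
  have hK' : ∀ k, Measurable fun x => loopPoint (e := e) (p := p) x k := fun k =>
    (measurable_pi_apply k).comp hK
  have hr : ∀ k, Measurable fun x => (N.contourPoint σ x).right k := fun k => by
    rw [funext fun x => N.contourPoint_right σ x k]
    have := hK' k
    fun_prop
  have hi : ∀ i j, Measurable fun x => (N.contourPoint σ x).inner i j := fun i j => by
    rw [funext fun x => congrFun (congrFun (N.contourPoint_inner σ x) i) j]
    unfold symMatrix
    split_ifs with h1 h2
    · have := hP' ⟨(i, j), h1⟩
      fun_prop
    · have := hP' ⟨(j, i), h2⟩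
      fun_prop
    · exact measurable_const
  exact (Finset.measurable_prod _ fun k _ => (hr k).betaB
    (Finset.measurable_sum _ fun j _ => hi k j).neg).mul
    (Finset.measurable_prod _ fun q _ => (hi _ _).betaB measurable_const)

theorem integrable_loopIntegrand_chain (hσ : N.IsLoopContour δ e p σ)
    (hc : N.IsChainContour γ ω fun a => (N.chainMandelstam (N.contourPoint σ 0) a).re) :
    Integrable fun x : IndepVar e p → ℝ =>
      N.loopIntegrand (N.chainPreAmplitude γ ω) δ e p (upwardLine σ x) := by
  simp only [loopIntegrand_contourPoint]
  obtain ⟨C, m, hC, h⟩ := N.polyBounded_chainPreAmplitude hc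
  set d := Module.finrank ℝ (IndepVar e p → ℝ)
  obtain ⟨C', hC', h'⟩ := N.exists_norm_kernel_le hσ (m + (d + 1))
  have hi : Integrable fun x : IndepVar e p → ℝ => (C * C') * (1 + ‖x‖) ^ (-((d + 1 : ℕ) : ℝ)) :=
    (integrable_one_add_norm (by push_cast; linarith)).const_mul _
  refine hi.mono' ((N.measurable_chainPreAmplitude γ ω).mul
    (N.measurable_kernel σ δ)).aestronglyMeasurable (Filter.Eventually.of_forall fun x => ?_)
  rw [norm_mul, Real.rpow_neg (by positivity), Real.rpow_natCast]
  calc _ ≤ (C * (1 + ‖x‖) ^ m) * (C' * ((1 + ‖x‖) ^ (m + (d + 1)))⁻¹) :=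
        mul_le_mul (h x) (h' x) (norm_nonneg _) (by positivity)
    _ = _ := by
        rw [pow_add]
        field_simp

end chain

end NecklaceChain

theorem mainTheorem6 {n r : ℕ} (N : NecklaceChain n r)
    (δ : Fin n → Fin n → ℂ) (hδ : N.IsCanonical δ)
    (e : Fin n × Fin n) (he : e.1 < e.2) (p : Fin n)
    (σ : IndepVar e p → ℝ) (hσ : N.IsLoopContour δ e p σ) :
    (∀ M₀ : (Finset.Icc 2 r → ℂ) → ℂ,
      Integrable (fun x : IndepVar e p → ℝ => N.loopIntegrand M₀ δ e p (upwardLine σ x)) →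
      Integrable (fun x : N.ReducedVar → ℝ =>
        N.reducedIntegrand M₀ (N.planar δ) (downwardLine (N.reducedContour e p σ) x)) ∧
      N.loopPreAmplitude M₀ δ e p σ =
        1 / (-2) ^ Fintype.card N.ReducedVar *
          mellinDown (N.reducedContour e p σ) (N.reducedIntegrand M₀ (N.planar δ))) ∧
    (∀ (γ : ℕ → ℂ) (ω : ℕ → Fin 2 → ℝ),
      N.IsChainContour γ ω
        (fun a => (N.chainMandelstam (N.solve e p fun v => (σ v : ℂ)) a).re) →
      Integrable (fun x : IndepVar e p → ℝ =>
        N.loopIntegrand (N.chainPreAmplitude γ ω) δ e p (upwardLine σ x)) ∧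
      Integrable (fun x : N.ReducedVar → ℝ =>
        N.reducedIntegrand (N.chainPreAmplitude γ ω) (N.planar δ)
          (downwardLine (N.reducedContour e p σ) x)) ∧
      N.loopPreAmplitude (N.chainPreAmplitude γ ω) δ e p σ =
        1 / (-2) ^ Fintype.card N.ReducedVar *
          mellinDown (N.reducedContour e p σ)
            (N.reducedIntegrand (N.chainPreAmplitude γ ω) (N.planar δ))) := by
  refine ⟨fun M₀ hint => N.reduction_formula he hδ hσ M₀ hint, fun γ ω hc => ?_⟩
  rw [← N.contourPoint_zero σ] at hc
  have hint := N.integrable_loopIntegrand_chain hσ hc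
  exact ⟨hint, N.reduction_formula he hδ hσ _ hint⟩
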